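/- Let $d\ge 2$. Let $\mathbb S_d$ be the space of symmetric real $d\times d$ matrices with $\langle x,y\rangle=\mathrm{tr}(xy)$ and $\|x\|=\langle x,x\rangle^{1/2}$, and let $\mathbb S_d^+$ be the cone of positive semidefinite matrices. An $\mathbb S_d^+$-valued measure $\mu$ on $\mathbb S_d^+\setminus\{0\}$ is a symmetric matrix $(\mu_{ij})$ of real countably additive set functions on the Borel sets $A$ with $0\notin\overline A$, such that $\mu(A)\in\mathbb S_d^+$ for all such $A$; $\mathrm{tr}(\mu)$ is the measure with $\mathrm{tr}(\mu)(A)=\mathrm{tr}(\mu(A))$. Let $(\alpha,b,B,m,\mu)$ be admissible parameters, that is: $\alpha,b\in\mathbb S_d^+$ with $b-(d-1)\alpha\in\mathbb S_d^+$; $m$ is a Borel measure on $\mathbb S_d^+\setminus\{0\}$ with $\int(\|\xi\|\wedge 1)\,m(d\xi)<\infty$; $\mu$ is an $\mathbb S_d^+$-valued measure on $\mathbb S_d^+\setminus\{0\}$ with $\int\|\xi\|\,\mathrm{tr}(\mu)(d\xi)<\infty$; $B:\mathbb S_d\to\mathbb S_d$ is linear with $\langle B(x),u\rangle\ge 0$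 for all $x,u\in\mathbb S_d^+$ with $\langle x,u\rangle=0$. Put $$F(u)=\langle b,u\rangle-\int(e^{-\langle u,\xi\rangle}-1)\,m(d\xi),\qquad R(u)=-2u\alpha u+B^\top(u)-\int(e^{-\langle u,\xi\rangle}-1)\,\mu(d\xi),$$ $$\widetilde B(u)=B(u)+\int\xi\,\langle u,\mu(d\xi)\rangle ,\qquad u\in\mathbb S_d ,$$ where $B^\top$ is the adjoint of $B$ and $\langle u,\mu(d\xi)\rangle=\sum_{i,j}u_{ij}\,\mu_{ij}(d\xi)$ (for $F$ and $R$, $u\in\mathbb S_d^+$). Let $(p_t(x,d\xi))_{t\ge0}$ be the transition kernel of the affine process with these parameters: a stochastically continuous Markov transition function on $\mathbb S_d^+$ with $$\int_{\mathbb S_d^+}e^{-\langle u,\xi\rangle}p_t(x,d\xi)=\exp\bigl(-\phi(t,u)-\langle\psi(t,u),x\rangle\bigr),\qquad t\ge0,\ x,u\in\mathbb S_d^+,$$ where $\phi(\cdot,u)$ is real-valued, $\psi(\cdot,u)$ is $\mathbb S_d^+$-valued, and $\partial_t\phi=F(\psi)$, $\phi(0,u)=0$, $\partial_t\psi=R(\psi)$,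 $\psi(0,u)=u$. Assume that the process is subcritical, i.e. $\sup\{\mathrm{Re}\,\lambda:\lambda\in\sigma(\widetilde B)\}<0$ (complex spectrum), and that $\int_{\{\|\xi\|>1\}}\|\xi\|\,m(d\xi)<\infty$. Then there is a unique invariant distribution $\pi$, that is, a unique Borel probability measure on $\mathbb S_d^+$ with $\int p_t(x,\cdot)\,\pi(dx)=\pi$ for all $t\ge0$. It has a finite first moment, $\int\|y\|\,\pi(dy)<\infty$; the measures $p_t(x,\cdot)$ have finite first moments; and for every $x\in\mathbb S_d^+$ $$\lim_{t\to\infty}\int_{\mathbb S_d^+}y\,p_t(x,dy)=\int_{\mathbb S_d^+}y\,\pi(dy)=\int_0^\infty e^{s\widetilde B}\Bigl(b+\int_{\mathbb S_d^+\setminus\{0\}}\xi\,m(d\xi)\Bigr)ds,$$ where the integral $\int\xi\,m(d\xi)$ and the integral over $s$ converge absolutely. -/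

import Mathlib

open MeasureTheory ProbabilityTheory Filter Topology Set
open scoped NNReal ENNReal Matrix TensorProduct

namespace AffinePSD

/-! ### Symmetric matrices with the trace scalar product -/

/-- The subspace of symmetric real `d × d` matrices. -/
def symmSubmodule (d : ℕ) : Submodule ℝ (Matrix (Fin d) (Fin d) ℝ) where
  carrier := {x | x.IsSymm}
  add_mem' := fun hx hy => Matrix.IsSymm.add hx hy
  zero_mem' := Matrix.isSymm_zero
  smul_mem' := fun c _ hx => Matrix.IsSymm.smul hx c

variable {d : ℕ}

theorem trace_mul_self_eq (x : symmSubmodule d) :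
    (x.1 * x.1).trace = ∑ i, ∑ j, x.1 i j ^ 2 := by
  simp only [Matrix.trace, Matrix.diag, Matrix.mul_apply]
  refine Finset.sum_congr rfl fun i _ => Finset.sum_congr rfl fun j _ => ?_
  rw [Matrix.IsSymm.apply x.2 i j, sq]

/-- The scalar product `⟨x, y⟩ = tr (x y)` on symmetric matrices. -/
@[reducible]
noncomputable def innerCore (d : ℕ) : InnerProductSpace.Core ℝ (symmSubmodule d) where
  inner x y := (x.1 * y.1).trace
  conj_inner_symm x y := by simpa using Matrix.trace_mul_comm y.1 x.1
  re_inner_nonneg x := by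
    change 0 ≤ (x.1 * x.1).trace
    rw [trace_mul_self_eq]
    exact Finset.sum_nonneg (fun i _ => Finset.sum_nonneg (fun j _ => sq_nonneg (x.1 i j)))
  add_left x y z := by simp [add_mul]
  smul_left x y r := by simp
  definite x hx := by
    have hx' : (x.1 * x.1).trace = 0 := hx
    rw [trace_mul_self_eq] at hx'
    apply Subtype.ext
    ext i j
    have h1 := (Finset.sum_eq_zero_iff_of_nonneg
      (fun i _ => Finset.sum_nonneg fun j _ => sq_nonneg (x.1 i j))).1 hx' i (Finset.mem_univ i)
    have h2 := (Finset.sum_eq_zero_iff_of_nonneg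
      (fun j _ => sq_nonneg (x.1 i j))).1 h1 j (Finset.mem_univ j)
    simpa using h2

/-- The space `𝕊_d` of symmetric real `d × d` matrices. It is a type of its own, so that the only
norm on it is the one that comes from the trace scalar product. -/
def SymMat (d : ℕ) : Type := symmSubmodule d

noncomputable instance : NormedAddCommGroup (SymMat d) := (innerCore d).toNormedAddCommGroup

noncomputable instance : InnerProductSpace ℝ (SymMat d) :=
  InnerProductSpace.ofCore (innerCore d).toCore

/-- The inclusion of `𝕊_d` into all matrices. -/
noncomputable def toMat : SymMat d →ₗ[ℝ] Matrix (Fin d) (Fin d) ℝ := (symmSubmodule d).subtype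

/-- A symmetric matrix as an element of `𝕊_d`. -/
def ofSymm (x : Matrix (Fin d) (Fin d) ℝ) (hx : x.IsSymm) : SymMat d := ⟨x, hx⟩

@[simp] theorem toMat_ofSymm (x : Matrix (Fin d) (Fin d) ℝ) (hx : x.IsSymm) :
    toMat (ofSymm x hx) = x := rfl

theorem toMat_isSymm (x : SymMat d) : (toMat x).IsSymm := Subtype.property x

theorem toMat_injective : Function.Injective (toMat : SymMat d → Matrix (Fin d) (Fin d) ℝ) :=
  Subtype.val_injective

instance : FiniteDimensional ℝ (SymMat d) := Module.Finite.of_injective toMat toMat_injective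

theorem inner_eq_trace (x y : SymMat d) : inner ℝ x y = (toMat x * toMat y).trace := rfl

noncomputable instance : CompleteSpace (SymMat d) := FiniteDimensional.complete ℝ (SymMat d)

noncomputable instance : MeasurableSpace (SymMat d) := borel (SymMat d)

instance : BorelSpace (SymMat d) := ⟨rfl⟩

/-! ### The cone of positive semidefinite matrices -/

/-- The cone `𝕊_d⁺` of symmetric positive semidefinite matrices. -/
def cone (d : ℕ) : Set (SymMat d) := {x | (toMat x).PosSemidef}

/-- The state space `𝕊_d⁺` as a type (with the subspace topology and its Borel sets). -/
abbrev Cone (d : ℕ) : Type := cone d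

/-- The punctured cone `𝕊_d⁺ \ {0}` as a type. -/
abbrev PuncturedCone (d : ℕ) : Type := ↥(cone d \ {0})

theorem inner_nonneg_of_mem_cone {x y : SymMat d} (hx : x ∈ cone d) (hy : y ∈ cone d) :
    0 ≤ inner ℝ x y := by
  rw [inner_eq_trace]
  have hx' : (toMat x).PosSemidef := hx
  have hy' : (toMat y).PosSemidef := hy
  obtain ⟨c, hc⟩ : ∃ c : Matrix (Fin d) (Fin d) ℝ, toMat y = cᴴ * c := by
    open scoped MatrixOrder Matrix.Norms.L2Operator in
    exact CStarAlgebra.nonneg_iff_eq_star_mul_self.1 hy'.nonneg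
  rw [hc, ← mul_assoc, Matrix.trace_mul_comm, ← mul_assoc]
  exact (hx'.mul_mul_conjTranspose_same c).trace_nonneg

/-- The matrix `v vᵀ`. -/
def rankOne (v : Fin d → ℝ) : Cone d :=
  ⟨ofSymm (Matrix.vecMulVec v v) (by
      ext i j; simp [Matrix.vecMulVec_apply, mul_comm]), by
    change (Matrix.vecMulVec v v).PosSemidef
    simpa using Matrix.posSemidef_vecMulVec_self_star v⟩

/-- The identity matrix, as an element of the cone. -/
def oneCone (d : ℕ) : Cone d :=
  ⟨ofSymm 1 Matrix.isSymm_one, by simpa [cone] using Matrix.PosSemidef.one⟩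

/-! ### Cone-valued measures on the punctured cone -/

/-- The set `A` is bounded away from the origin: `0 ∉ closure A`, closure in `𝕊_d`. -/
def AwayFromZero (A : Set (PuncturedCone d)) : Prop :=
  (0 : SymMat d) ∉ closure ((fun ξ : PuncturedCone d => (ξ : SymMat d)) '' A)

theorem AwayFromZero.mono {A C : Set (PuncturedCone d)} (h : AwayFromZero C) (hAC : A ⊆ C) :
    AwayFromZero A := fun h0 => h (closure_mono (Set.image_mono hAC) h0)

theorem awayFromZero_of_le {A : Set (PuncturedCone d)} {ε : ℝ} (hε : 0 < ε)
    (h : ∀ ξ ∈ A, ε ≤ ‖(ξ : SymMat d)‖) : AwayFromZero A := by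
  intro h0
  obtain ⟨_, ⟨ξ, hξ, rfl⟩, hlt⟩ := Metric.mem_closure_iff.1 h0 ε hε
  rw [dist_zero_left] at hlt
  exact absurd hlt (not_lt.2 (h ξ hξ))

/-- An `𝕊_d⁺`-valued measure on `𝕊_d⁺ \ {0}`: a matrix `(μ_{ij})` of countably additive real set
functions, finite on the Borel sets bounded away from the origin (no total mass is required to
exist near the origin), with `μ(A) ∈ 𝕊_d⁺` for each such set `A`. Only the values on these sets
carry meaning. Since `𝕊_d⁺ \ {0}` is a countable union of them, `μ` is sigma-finite. -/
structure ConeMeasure (d : ℕ) where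
  toFun : Set (PuncturedCone d) → SymMat d
  mem_cone : ∀ A, MeasurableSet A → AwayFromZero A → toFun A ∈ cone d
  hasSum_iUnion : ∀ A : ℕ → Set (PuncturedCone d), (∀ n, MeasurableSet (A n)) →
    Pairwise (Function.onFun Disjoint A) → AwayFromZero (⋃ n, A n) →
    HasSum (fun n => toFun (A n)) (toFun (⋃ n, A n))

/-- The shell of all `ξ` with `n ≤ 1 / ‖ξ‖ < n + 1`. -/
def shell (d n : ℕ) : Set (PuncturedCone d) := {ξ | ⌊‖(ξ : SymMat d)‖⁻¹⌋₊ = n}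

theorem measurableSet_shell (n : ℕ) : MeasurableSet (shell d n) := by
  have h : Measurable fun ξ : PuncturedCone d => ⌊‖(ξ : SymMat d)‖⁻¹⌋₊ :=
    Nat.measurable_floor.comp (measurable_subtype_coe.norm.inv)
  exact h (measurableSet_singleton n)

theorem awayFromZero_shell (n : ℕ) : AwayFromZero (shell d n) := by
  refine awayFromZero_of_le (ε := ((n : ℝ) + 1)⁻¹) (by positivity) fun ξ hξ => ?_
  have hpos : 0 < ‖(ξ : SymMat d)‖ := norm_pos_iff.2 ξ.2.2
  have h : ‖(ξ : SymMat d)‖⁻¹ < (n : ℝ) + 1 := by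
    have := Nat.lt_floor_add_one (‖(ξ : SymMat d)‖⁻¹)
    rwa [show ⌊‖(ξ : SymMat d)‖⁻¹⌋₊ = n from hξ] at this
  exact inv_le_of_inv_le₀ hpos h.le

theorem iUnion_shell (d : ℕ) : ⋃ n, shell d n = univ :=
  Set.eq_univ_of_forall fun _ => Set.mem_iUnion.2 ⟨_, rfl⟩

theorem disjoint_shell (d : ℕ) : Pairwise (Function.onFun Disjoint (shell d)) := by
  intro i j hij
  rw [Function.onFun, Set.disjoint_left]
  rintro ξ hi hj
  exact hij ((show ⌊‖(ξ : SymMat d)‖⁻¹⌋₊ = i from hi).symm.trans hj)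

namespace ConeMeasure

variable (μ : ConeMeasure d)

theorem toFun_empty : μ.toFun ∅ = 0 := by
  have h := μ.hasSum_iUnion (fun _ => ∅) (fun _ => MeasurableSet.empty)
    (fun i j _ => by simp [Function.onFun]) (by simp [AwayFromZero])
  have h1 := h.summable.tendsto_atTop_zero
  simpa using tendsto_nhds_unique tendsto_const_nhds h1

theorem inner_hasSum (u : Cone d) (A : ℕ → Set (PuncturedCone d)) (hA : ∀ n, MeasurableSet (A n))
    (hd : Pairwise (Function.onFun Disjoint A)) (h0 : AwayFromZero (⋃ n, A n)) :
    ENNReal.ofReal (inner ℝ (u : SymMat d) (μ.toFun (⋃ n, A n))) =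
      ∑' n, ENNReal.ofReal (inner ℝ (u : SymMat d) (μ.toFun (A n))) := by
  have h := (μ.hasSum_iUnion A hA hd h0).mapL (innerSL ℝ (u : SymMat d))
  simp only [innerSL_apply_apply] at h
  rw [← h.tsum_eq, ENNReal.ofReal_tsum_of_nonneg _ h.summable]
  exact fun n => inner_nonneg_of_mem_cone u.2
    (μ.mem_cone _ (hA n) (h0.mono (Set.subset_iUnion A n)))

/-- The restriction of `⟨u, μ(·)⟩` to a shell. -/
noncomputable def shellPairing (u : Cone d) (n : ℕ) : Measure (PuncturedCone d) :=
  Measure.ofMeasurable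
    (fun A _ => ENNReal.ofReal (inner ℝ (u : SymMat d) (μ.toFun (A ∩ shell d n))))
    (by simp [toFun_empty])
    (by
      intro A hA hdisj
      rw [Set.iUnion_inter]
      refine μ.inner_hasSum u _ (fun i => (hA i).inter (measurableSet_shell n)) ?_ ?_
      · exact fun i j hij => (hdisj hij).mono Set.inter_subset_left Set.inter_subset_left
      · rw [← Set.iUnion_inter]
        exact (awayFromZero_shell n).mono Set.inter_subset_right)

/-- For `u ∈ 𝕊_d⁺`, the (positive) measure `⟨u, μ(dξ)⟩` on `𝕊_d⁺ \ {0}`. By `pairing_apply` it is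
the measure with `A ↦ ⟨u, μ(A)⟩` on Borel sets bounded away from the origin. -/
noncomputable def pairing (u : Cone d) : Measure (PuncturedCone d) :=
  Measure.sum fun n => μ.shellPairing u n

theorem pairing_apply (u : Cone d) {A : Set (PuncturedCone d)} (hA : MeasurableSet A)
    (h0 : AwayFromZero A) :
    μ.pairing u A = ENNReal.ofReal (inner ℝ (u : SymMat d) (μ.toFun A)) := by
  have hU : ⋃ n, A ∩ shell d n = A := by
    rw [← Set.inter_iUnion, iUnion_shell, Set.inter_univ]
  rw [pairing, Measure.sum_apply _ hA]
  conv_rhs => rw [← hU]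
  rw [μ.inner_hasSum u _ (fun n => hA.inter (measurableSet_shell n))
    (fun i j hij => (disjoint_shell d hij).mono Set.inter_subset_right Set.inter_subset_right)
    (by rwa [hU])]
  exact tsum_congr fun n => Measure.ofMeasurable_apply A hA

/-- The measure `tr(μ)`, that is `tr(μ)(A) = tr(μ(A))`. -/
noncomputable def traceMeasure : Measure (PuncturedCone d) := μ.pairing (oneCone d)

theorem traceMeasure_apply {A : Set (PuncturedCone d)} (hA : MeasurableSet A)
    (h0 : AwayFromZero A) :
    μ.traceMeasure A = ENNReal.ofReal (toMat (μ.toFun A)).trace := by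
  rw [traceMeasure, pairing_apply μ _ hA h0, inner_eq_trace]
  simp [oneCone]

/-- The integral `∫ g dμ_{ij}` against the entry `μ_{ij}` of `μ`. The signed measure `μ_{ij}` is
written, by polarization of the symmetric matrix `μ(A)`, as a combination of the positive measures
`vᵀ μ(·) v = ⟨v vᵀ, μ(·)⟩`:
`2 μ_{ij} = (e_i + e_j)ᵀ μ (e_i + e_j) - e_iᵀ μ e_i - e_jᵀ μ e_j`. -/
noncomputable def entryIntegral {E : Type*} [NormedAddCommGroup E] [NormedSpace ℝ E]
    (i j : Fin d) (g : PuncturedCone d → E) : E :=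
  (1 / 2 : ℝ) •
    ((∫ ξ, g ξ ∂(μ.pairing (rankOne (Pi.single i 1 + Pi.single j 1))))
      - (∫ ξ, g ξ ∂(μ.pairing (rankOne (Pi.single i 1))))
      - ∫ ξ, g ξ ∂(μ.pairing (rankOne (Pi.single j 1))))

/-- The matrix `∫ g(ξ) μ(dξ) ∈ 𝕊_d`, with entries `∫ g dμ_{ij}`, for a real function `g`. -/
noncomputable def integral (g : PuncturedCone d → ℝ) : SymMat d :=
  ofSymm (Matrix.of fun i j => μ.entryIntegral i j g) (by
    ext i j
    simp only [Matrix.transpose_apply, Matrix.of_apply, entryIntegral]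
    rw [add_comm (Pi.single j 1 : Fin d → ℝ), sub_right_comm])

/-- The linear map `u ↦ ∫ ξ ⟨u, μ(dξ)⟩ = ∑_{i,j} u_{ij} ∫ ξ μ_{ij}(dξ)` on `𝕊_d`. -/
noncomputable def meanJump : SymMat d →L[ℝ] SymMat d :=
  LinearMap.toContinuousLinearMap
    (∑ i, ∑ j, (Matrix.entryLinearMap ℝ ℝ i j ∘ₗ toMat).smulRight
      (μ.entryIntegral i j fun ξ => (ξ : SymMat d)))

theorem meanJump_apply (u : SymMat d) :
    μ.meanJump u = ∑ i, ∑ j, toMat u i j • μ.entryIntegral i j fun ξ => (ξ : SymMat d) := by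
  simp [meanJump]

end ConeMeasure

/-! ### Admissible parameters, the functions `F` and `R`, the effective drift -/

/-- Admissible parameters `(α, b, B, m, μ)`. (On the finite-dimensional space `𝕊_d` every linear
map is continuous.) -/
structure AdmissibleParameters (d : ℕ) where
  /-- linear diffusion coefficient -/
  α : SymMat d
  /-- constant drift -/
  b : SymMat d
  /-- linear drift -/
  B : SymMat d →L[ℝ] SymMat d
  /-- constant jump measure -/
  m : Measure (PuncturedCone d)
  /-- linear jump coefficient -/
  μ : ConeMeasure d
  α_mem : α ∈ cone d
  b_mem : b ∈ cone d
  b_ge : b - ((d : ℝ) - 1) • α ∈ cone d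
  m_small : ∫⁻ ξ, ENNReal.ofReal (min ‖(ξ : SymMat d)‖ 1) ∂m < ∞
  μ_moment : ∫⁻ ξ, ‖(ξ : SymMat d)‖ₑ ∂μ.traceMeasure < ∞
  B_inward : ∀ x ∈ cone d, ∀ u ∈ cone d, inner ℝ x u = 0 → 0 ≤ inner ℝ (B x) u

namespace AdmissibleParameters

variable (P : AdmissibleParameters d)

/-- `F(u) = ⟨b, u⟩ - ∫ (exp(-⟨u, ξ⟩) - 1) m(dξ)`. -/
noncomputable def F (u : SymMat d) : ℝ :=
  inner ℝ P.b u - ∫ ξ, (Real.exp (-inner ℝ u (ξ : SymMat d)) - 1) ∂P.m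

/-- The symmetric matrix `u α u`. -/
noncomputable def sandwich (u α : SymMat d) : SymMat d :=
  ofSymm (toMat u * toMat α * toMat u) (by
    simp only [Matrix.IsSymm, Matrix.transpose_mul, (toMat_isSymm _).eq, mul_assoc])

/-- `R(u) = -2 u α u + Bᵀ(u) - ∫ (exp(-⟨u, ξ⟩) - 1) μ(dξ)`. -/
noncomputable def R (u : SymMat d) : SymMat d :=
  -((2 : ℝ) • sandwich u P.α) + ContinuousLinearMap.adjoint P.B u
    - P.μ.integral fun ξ => Real.exp (-inner ℝ u (ξ : SymMat d)) - 1

/-- The effective drift `B̃(u) = B(u) + ∫ ξ ⟨u, μ(dξ)⟩`. -/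
noncomputable def effectiveDrift : SymMat d →L[ℝ] SymMat d := P.B + P.μ.meanJump

/-- Subcriticality: the supremum of the real parts of the (finitely many, complex) points of the
spectrum of `B̃` is negative. -/
def Subcritical : Prop :=
  sSup (Complex.re '' spectrum ℂ
    ((LinearMap.baseChange ℂ (P.effectiveDrift : SymMat d →ₗ[ℝ] SymMat d) :
      Module.End ℂ (ℂ ⊗[ℝ] SymMat d)))) < 0

/-- `(φ, ψ)` solves the generalized Riccati equations on `[0, ∞)` (one-sided derivative at `0`),
for all initial values `u ∈ 𝕊_d⁺`. Only times `t ≥ 0` matter. -/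
def IsRiccatiSolution (φ : ℝ → Cone d → ℝ) (ψ : ℝ → Cone d → Cone d) : Prop :=
  ∀ u : Cone d, φ 0 u = 0 ∧ ψ 0 u = u ∧ ∀ t : ℝ, 0 ≤ t →
    HasDerivWithinAt (fun s => φ s u) (P.F (ψ t u)) (Ici 0) t ∧
    HasDerivWithinAt (fun s => (ψ s u : SymMat d)) (P.R (ψ t u)) (Ici 0) t

/-- `p` is the transition kernel of the affine process on `𝕊_d⁺` with admissible parameters `P`: a
stochastically continuous Markov transition function on `𝕊_d⁺` with
`∫ exp(-⟨u, ξ⟩) p_t(x, dξ) = exp(-φ(t, u) - ⟨ψ(t, u), x⟩)`, where `(φ, ψ)` solves the generalized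
Riccati equations. -/
structure IsTransitionKernel (p : ℝ≥0 → Kernel (Cone d) (Cone d)) : Prop where
  isMarkovKernel : ∀ t, IsMarkovKernel (p t)
  zero : p 0 = Kernel.id
  chapman_kolmogorov : ∀ s t, p (s + t) = p t ∘ₖ p s
  stochastically_continuous : ∀ (x : Cone d) (f : BoundedContinuousFunction (Cone d) ℝ),
    Continuous fun t => ∫ y, f y ∂(p t x)
  laplace : ∃ (φ : ℝ → Cone d → ℝ) (ψ : ℝ → Cone d → Cone d), P.IsRiccatiSolution φ ψ ∧
    ∀ (t : ℝ≥0) (x u : Cone d),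
      ∫ ξ, Real.exp (-inner ℝ (u : SymMat d) (ξ : SymMat d)) ∂(p t x) =
        Real.exp (-φ t u - inner ℝ (ψ t u : SymMat d) (x : SymMat d))

end AdmissibleParameters

/-- An invariant distribution of the transition kernel `p`: a Borel probability measure `π` with
`∫ p_t(x, dξ) π(dx) = π(dξ)` for all `t ≥ 0`. -/
def IsInvariantDistribution (p : ℝ≥0 → Kernel (Cone d) (Cone d)) (π : Measure (Cone d)) : Prop :=
  IsProbabilityMeasure π ∧ ∀ t, Kernel.Invariant (p t) π

end AffinePSD

/-! ### Exponential stability of linear maps -/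

section ExponentialStability

/-! Everything is read off from the Laplace transform near `u = 0`. At the origin of the cone the
Riccati fields `R` and `F` have derivatives `B̃ᵀ` and `⟨β, ·⟩`, with `β = b + ∫ ξ m(dξ)`
(`hasFDerivWithinAt_R`, `hasFDerivWithinAt_F`). Hence `ψ(t, εu) ≈ ε exp(tB̃ᵀ) u` and `φ(t, εu) ≈ ε
⟨u, ∫₀ᵗ exp(sB̃) β ds⟩` (`linearize_psi`, `linearize_phi`), and `p_t(x, ·)` has mean `exp(tB̃) x +
∫₀ᵗ exp(sB̃) β ds`.

The mean in turn controls the transform at every `u`. Jensen's inequality (`exponent_le`) bounds `φ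
+ ⟨ψ, x⟩` by the pairing of `u` with the mean, and sending the starting point to infinity along a
ray leaves `⟨ψ(t, u), x⟩ ≤ ⟨u, exp(tB̃) x⟩` (`inner_psi_le`). Subcriticality makes `exp(tB̃)` decay
exponentially, so `ψ → 0`, while `φ` is increasing and bounded. No stability theory for the
nonlinear flow is needed.

The transforms of `p_t(x, ·)` therefore converge to a limit `L` free of `x`. Bounded means give
tightness, and Prokhorov's theorem yields a law `π` with transform `L`
(`exists_laplace_eq_of_tendsto`). Chapman–Kolmogorov makes `π` invariant, every invariant law has
transform `L`, and `ext_of_laplace` gives uniqueness. The bounded means pass to `π`, and its mean is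
a fixed point of `x ↦ exp(tB̃) x + ∫₀ᵗ exp(sB̃) β ds`; letting `t → ∞` identifies it. -/

theorem ContinuousLinearMap.exp_apply_of_eigenvector {V : Type*} [NormedAddCommGroup V]
    [NormedSpace ℂ V] [CompleteSpace V] (T : V →L[ℂ] V) (c : ℂ) (v : V) (h : T v = c • v) :
    NormedSpace.exp T v = Complex.exp c • v := by
  have hp : ∀ n : ℕ, (T ^ n) v = c ^ n • v := by
    intro n
    induction n with
    | zero => simp
    | succ n ih => rw [pow_succ, mul_apply_eq_comp, h, map_smul, ih, smul_smul, pow_succ,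
        mul_comm]
  have h1 := (NormedSpace.exp_series_hasSum_exp' (𝕂 := ℂ) T).mapL (ContinuousLinearMap.apply ℂ V v)
  have h2 := (NormedSpace.exp_series_hasSum_exp' (𝕂 := ℂ) c).smul_const v
  simp only [ContinuousLinearMap.apply_apply, _root_.smul_apply, hp] at h1
  rw [← Complex.exp_eq_exp_ℂ] at h2
  refine h1.unique ?_
  simpa [smul_smul] using h2

/-- Since `T` commutes with its exponential, it preserves each eigenspace of the exponential, and
over `ℂ` it has an eigenvector there. -/
theorem ContinuousLinearMap.spectrum_exp_subset {V : Type*} [NormedAddCommGroup V]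
    [NormedSpace ℂ V] [FiniteDimensional ℂ V] (T : V →L[ℂ] V) :
    spectrum ℂ (NormedSpace.exp T) ⊆ Complex.exp '' spectrum ℂ T := by
  have : CompleteSpace V := FiniteDimensional.complete ℂ V
  have hs : ∀ S : V →L[ℂ] V, spectrum ℂ S = spectrum ℂ (S : V →ₗ[ℂ] V) := fun S =>
    (AlgEquiv.spectrum_eq (Module.End.toContinuousLinearMap (𝕜 := ℂ) V).symm S).symm
  intro l hl
  rw [hs, ← Module.End.hasEigenvalue_iff_mem_spectrum] at hl
  set g : Module.End ℂ V := ((NormedSpace.exp T : V →L[ℂ] V) : V →ₗ[ℂ] V) with hg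
  have hc : Commute T (NormedSpace.exp T) := (Commute.refl T).exp_right
  have hmap : ∀ x ∈ Module.End.eigenspace g l, (T : V →ₗ[ℂ] V) x ∈ Module.End.eigenspace g l := by
    intro x hx
    rw [Module.End.mem_eigenspace_iff] at hx ⊢
    have h1 : NormedSpace.exp T (T x) = T (NormedSpace.exp T x) := by
      have := congrArg (fun S : V →L[ℂ] V => S x) hc.eq
      simpa using this.symm
    have h2 : NormedSpace.exp T x = l • x := hx
    change NormedSpace.exp T (T x) = l • T x
    rw [h1, h2, map_smul]
  have : Nontrivial (Module.End.eigenspace g l) := Submodule.nontrivial_iff_ne_bot.2 hl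
  obtain ⟨c, hcc⟩ := Module.End.exists_eigenvalue ((T : V →ₗ[ℂ] V).restrict hmap)
  obtain ⟨v, hv⟩ := hcc.exists_hasEigenvector
  have hv1 : T (v : V) = c • (v : V) := by
    have := congrArg Subtype.val hv.apply_eq_smul
    simpa using this
  have hv0 : (v : V) ≠ 0 := fun h => hv.2 (Subtype.ext h)
  refine ⟨c, ?_, ?_⟩
  · rw [hs, ← Module.End.hasEigenvalue_iff_mem_spectrum]
    exact Module.End.hasEigenvalue_of_hasEigenvector
      (x := (v : V)) ⟨Module.End.mem_eigenspace_iff.2 hv1, hv0⟩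
  · have h1 := T.exp_apply_of_eigenvector c v hv1
    have h2 : NormedSpace.exp T (v : V) = l • (v : V) := Module.End.mem_eigenspace_iff.1 v.2
    exact smul_left_injective ℂ hv0 (h1.symm.trans h2)

/-- A one-parameter group with a contracting element decays exponentially. -/
theorem NormedSpace.exists_norm_exp_smul_le {𝔸 : Type*} [NormedRing 𝔸] [NormedAlgebra ℝ 𝔸]
    [CompleteSpace 𝔸] (a : 𝔸) (n : ℕ) (hn : 0 < n)
    (h : ‖NormedSpace.exp a ^ n‖ < 1) :
    ∃ C δ : ℝ, 0 < δ ∧ 0 ≤ C ∧ ∀ t : ℝ, 0 ≤ t → ‖NormedSpace.exp (t • a)‖ ≤ C * Real.exp (-δ * t) := by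
  let : NormedAlgebra ℚ 𝔸 := NormedAlgebra.restrictScalars ℚ ℝ 𝔸
  obtain ⟨q, hq, hq1⟩ := exists_between h
  have hq0 : 0 < q := (norm_nonneg _).trans_lt hq
  have hn' : (0 : ℝ) < n := by exact_mod_cast hn
  have hcont : Continuous fun t : ℝ => NormedSpace.exp (t • a) := by
    exact NormedSpace.exp_continuous.comp (continuous_id.smul continuous_const)
  obtain ⟨M, hM⟩ := (isCompact_Icc (a := (0 : ℝ)) (b := n)).exists_bound_of_continuousOn
    hcont.continuousOn
  have hM0 : 0 ≤ M := (norm_nonneg _).trans (hM 0 ⟨le_rfl, hn'.le⟩)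
  -- The rate is chosen so that `q = exp (-δ n)`: each full period `n` gains a factor `q`.
  set δ : ℝ := -Real.log q / n with hδ
  have hδ0 : 0 < δ := div_pos (neg_pos.2 (Real.log_neg hq0 hq1)) hn'
  have hqe : q = Real.exp (-δ * n) := by
    rw [hδ, show -(-Real.log q / (n : ℝ)) * n = Real.log q by field_simp, Real.exp_log hq0]
  refine ⟨M * q⁻¹, δ, hδ0, by positivity, fun t ht => ?_⟩
  set k := ⌊t / n⌋₊
  have hk1 : (k : ℝ) * n ≤ t := by
    rw [← le_div_iff₀ hn']; exact Nat.floor_le (by positivity)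
  have hk2 : t < (k + 1) * n := by
    rw [← div_lt_iff₀ hn']; exact Nat.lt_floor_add_one _
  have hsplit : NormedSpace.exp (t • a) =
      (NormedSpace.exp a ^ n) ^ k * NormedSpace.exp ((t - k * n) • a) := by
    rw [← pow_mul, ← NormedSpace.exp_nsmul, ← NormedSpace.exp_add_of_commute]
    · congr 1
      rw [← Nat.cast_smul_eq_nsmul ℝ, ← add_smul]
      congr 1
      push_cast; ring
    · rw [← Nat.cast_smul_eq_nsmul ℝ]
      exact ((Commute.refl a).smul_left _).smul_right _
  -- The power is estimated together with a factor `y`, because `‖1‖ = 1` is not assumed in `𝔸` and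
  -- the case `k = 0` must hold.
  have hpow : ∀ (k : ℕ) (y : 𝔸), ‖(NormedSpace.exp a ^ n) ^ k * y‖ ≤ q ^ k * ‖y‖ := by
    intro k y
    induction k with
    | zero => simp
    | succ k ih =>
      rw [pow_succ', mul_assoc, pow_succ', mul_assoc]
      exact (norm_mul_le _ _).trans (mul_le_mul hq.le ih (norm_nonneg _) hq0.le)
  rw [hsplit]
  calc _ ≤ q ^ k * M := (hpow k _).trans (by
        gcongr; exact hM _ ⟨by linarith, by linarith⟩)
    _ = M * q⁻¹ * q ^ (k + 1) := by field_simp; ring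
    _ ≤ _ := by
      gcongr
      rw [hqe, ← Real.exp_nat_mul, Real.exp_le_exp]
      push_cast
      nlinarith

/-- Exponential stability of a real linear map with complex spectrum in the open left half plane. -/
theorem ContinuousLinearMap.exists_norm_exp_smul_le_of_spectrum {E : Type*} [NormedAddCommGroup E]
    [NormedSpace ℝ E] [FiniteDimensional ℝ E] (T : E →L[ℝ] E)
    (hT : ∀ z ∈ spectrum ℂ (LinearMap.baseChange ℂ (T : E →ₗ[ℝ] E) : Module.End ℂ (ℂ ⊗[ℝ] E)),
      z.re < 0) :
    ∃ C δ : ℝ, 0 < δ ∧ 0 ≤ C ∧ ∀ t : ℝ, 0 ≤ t → ‖NormedSpace.exp (t • T)‖ ≤ C * Real.exp (-δ * t) := by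
  have : CompleteSpace E := FiniteDimensional.complete ℝ E
  let ι := Module.Free.ChooseBasisIndex ℝ E
  let b : Module.Basis ι ℝ E := Module.Free.chooseBasis ℝ E
  classical
  rcases isEmpty_or_nonempty ι with hι | hι
  · have : Subsingleton E := b.repr.toEquiv.subsingleton
    have h0 : ∀ t : ℝ, NormedSpace.exp (t • T) = 0 := fun t => by
      ext x; exact Subsingleton.elim _ _
    exact ⟨0, 1, one_pos, le_rfl, fun t _ => by simp [h0]⟩
  let V := ι → ℂ
  let f1 := ((Module.End.toContinuousLinearMap (𝕜 := ℝ) E).symm : (E →L[ℝ] E) ≃ₐ[ℝ] _)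
  let f2 := (LinearMap.toMatrixAlgEquiv b : Module.End ℝ E ≃ₐ[ℝ] Matrix ι ι ℝ)
  let f3 : Matrix ι ι ℝ →ₐ[ℝ] Matrix ι ι ℂ := (Algebra.ofId ℝ ℂ).mapMatrix
  let f4 := (Matrix.toLinAlgEquiv' : Matrix ι ι ℂ ≃ₐ[ℂ] Module.End ℂ (ι → ℂ))
  let f5 := Module.End.toContinuousLinearMap (𝕜 := ℂ) V
  -- Complexification in coordinates: `Φ` lands in a complex Banach algebra, where Gelfand's formula
  -- applies. Being linear and injective in finite dimension it is antilipschitz, so norm bounds can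
  -- be pulled back.
  let Φ : (E →L[ℝ] E) →ₐ[ℝ] (V →L[ℂ] V) :=
    ((((f5.restrictScalars ℝ).toAlgHom.comp (f4.restrictScalars ℝ).toAlgHom).comp f3).comp
      f2.toAlgHom).comp f1.toAlgHom
  have hΦ : Function.Injective Φ := by
    have h3 : Function.Injective f3 := Matrix.map_injective (algebraMap ℝ ℂ).injective
    exact f5.injective.comp (f4.injective.comp (h3.comp (f2.injective.comp f1.injective)))
  have hspec : spectrum ℂ (Φ T) = spectrum ℂ
      (LinearMap.baseChange ℂ (T : E →ₗ[ℝ] E) : Module.End ℂ (ℂ ⊗[ℝ] E)) := by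
    have e1 : spectrum ℂ (Φ T) = spectrum ℂ (f3 (f2 (f1 T))) :=
      AlgEquiv.spectrum_eq (f4.trans f5) (f3 (f2 (f1 T)))
    rw [e1, ← AlgEquiv.spectrum_eq (LinearMap.toMatrixAlgEquiv (Algebra.TensorProduct.basis ℂ b))
      (LinearMap.baseChange ℂ (T : E →ₗ[ℝ] E) : Module.End ℂ (ℂ ⊗[ℝ] E))]
    congr 1
    exact (LinearMap.toMatrix_baseChange (A := ℂ) (T : E →ₗ[ℝ] E) b b).symm
  have hcont : Continuous Φ := Φ.toLinearMap.continuous_of_finiteDimensional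
  obtain ⟨K, -, hK⟩ := Φ.toLinearMap.exists_antilipschitzWith
    (LinearMap.ker_eq_bot.2 hΦ)
  have hrad : spectralRadius ℂ (NormedSpace.exp (Φ T)) < 1 := by
    have := spectrum.spectralRadius_lt_of_forall_lt (NormedSpace.exp (Φ T)) (r := 1) ?_
    · simpa using this
    · intro z hz
      obtain ⟨c, hc, rfl⟩ := ContinuousLinearMap.spectrum_exp_subset _ hz
      have hre := hT c (hspec ▸ hc)
      rw [← NNReal.coe_lt_coe]
      simp only [coe_nnnorm, Complex.norm_exp, NNReal.coe_one]
      simpa using hre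
  -- Gelfand's formula: spectral radius below `1` forces some positive power to be a strict
  -- contraction.
  obtain ⟨n, hn1, hn2⟩ := (((spectrum.pow_nnnorm_pow_one_div_tendsto_nhds_spectralRadius
    (NormedSpace.exp (Φ T))).eventually_lt_const hrad).and (eventually_gt_atTop 0)).exists
  have hlt : ‖NormedSpace.exp (Φ T) ^ n‖ < 1 := by
    have h1 : (‖NormedSpace.exp (Φ T) ^ n‖₊ : ℝ≥0∞) < 1 := by
      by_contra hcon
      exact absurd hn1 (not_lt.2 (ENNReal.one_le_rpow (not_lt.1 hcon) (by positivity)))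
    exact_mod_cast h1
  obtain ⟨C, δ, hδ, hC, h⟩ := NormedSpace.exists_norm_exp_smul_le (Φ T) n hn2 hlt
  refine ⟨K * C, δ, hδ, by positivity, fun t ht => ?_⟩
  let : NormedAlgebra ℚ (E →L[ℝ] E) := NormedAlgebra.restrictScalars ℚ ℝ _
  have h1 : Φ (NormedSpace.exp (t • T)) = NormedSpace.exp (t • Φ T) := by
    rw [NormedSpace.map_exp Φ hcont, map_smul]
  have h2 := ZeroHomClass.bound_of_antilipschitz Φ.toLinearMap hK (NormedSpace.exp (t • T))
  calc _ ≤ K * ‖Φ (NormedSpace.exp (t • T))‖ := h2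
    _ ≤ K * (C * Real.exp (-δ * t)) := by rw [h1]; gcongr; exact h t ht
    _ = _ := by ring

end ExponentialStability

namespace AffinePSD
variable {d : ℕ}

/-! ### Geometry of the cone -/

theorem inner_rankOne (v : Fin d → ℝ) (a : SymMat d) :
    inner ℝ (rankOne v : SymMat d) a = v ⬝ᵥ (toMat a *ᵥ v) := by
  rw [inner_eq_trace]
  change (Matrix.vecMulVec v v * toMat a).trace = _
  rw [Matrix.vecMulVec_mul, Matrix.trace_vecMulVec, ← Matrix.mulVec_transpose,
    (toMat_isSymm a).eq]

/-- The cone spans: the pairings with elements of the cone determine a symmetric matrix. -/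
theorem ext_inner_cone {a b : SymMat d}
    (h : ∀ u : Cone d, inner ℝ (u : SymMat d) a = inner ℝ (u : SymMat d) b) : a = b := by
  have h1 : ∀ i j, toMat a i j = toMat b i j := by
    intro i j
    -- Polarization: the quadratic form at `e_i + e_j`, `e_i` and `e_j` determines the entry `(i,
    -- j)`.
    have e := h (rankOne (Pi.single i 1 + Pi.single j 1))
    have e1 := h (rankOne (Pi.single i 1))
    have e2 := h (rankOne (Pi.single j 1))
    rw [inner_rankOne, inner_rankOne] at e e1 e2
    simp only [Matrix.mulVec_add, add_dotProduct, dotProduct_add, Matrix.mulVec_single_one,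
      single_one_dotProduct, Matrix.col_apply] at e e1 e2
    have s1 := Matrix.IsSymm.apply (toMat_isSymm a) i j
    have s2 := Matrix.IsSymm.apply (toMat_isSymm b) i j
    linarith
  exact toMat_injective (Matrix.ext h1)

theorem isClosed_cone (d : ℕ) : IsClosed (cone d) := by
  have : cone d = ⋂ v : Fin d → ℝ, {x | 0 ≤ inner ℝ (rankOne v : SymMat d) x} := by
    ext x
    simp only [mem_iInter, mem_ofPred_eq]
    refine ⟨fun hx v => inner_nonneg_of_mem_cone (rankOne v).2 hx, fun hx => ?_⟩
    refine Matrix.PosSemidef.of_dotProduct_mulVec_nonneg ?_ fun v => ?_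
    · rw [Matrix.IsHermitian, Matrix.conjTranspose_eq_transpose_of_trivial, (toMat_isSymm x).eq]
    · simpa [inner_rankOne] using hx v
  rw [this]
  exact isClosed_iInter fun v => isClosed_le continuous_const (by fun_prop)

instance : CompleteSpace (Cone d) := (isClosed_cone d).completeSpace_coe

theorem zero_mem_cone : (0 : SymMat d) ∈ cone d := by
  change (toMat (0 : SymMat d)).PosSemidef
  simpa using Matrix.PosSemidef.zero

theorem add_mem_cone {x y : SymMat d} (hx : x ∈ cone d) (hy : y ∈ cone d) : x + y ∈ cone d := by
  change (toMat (x + y)).PosSemidef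
  rw [map_add]
  exact Matrix.PosSemidef.add hx hy

theorem smul_mem_cone {x : SymMat d} (hx : x ∈ cone d) {c : ℝ} (hc : 0 ≤ c) : c • x ∈ cone d := by
  change (toMat (c • x)).PosSemidef
  rw [map_smul]
  exact Matrix.PosSemidef.smul hx hc

theorem inner_oneCone (x : SymMat d) : inner ℝ (oneCone d : SymMat d) x = (toMat x).trace := by
  rw [inner_eq_trace]
  change (1 * toMat x).trace = _
  rw [one_mul]

theorem norm_sq_eq_trace (x : SymMat d) : ‖x‖ ^ 2 = (toMat x * toMat x).trace := by
  rw [← real_inner_self_eq_norm_sq, inner_eq_trace]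

theorem trace_mul_self_eq' (x : SymMat d) :
    (toMat x * toMat x).trace = ∑ i, ∑ j, toMat x i j ^ 2 := trace_mul_self_eq x

/-- On the cone the trace dominates the norm. -/
theorem norm_le_inner_oneCone {x : SymMat d} (hx : x ∈ cone d) :
    ‖x‖ ≤ inner ℝ (oneCone d : SymMat d) x := by
  have hx' : (toMat x).PosSemidef := hx
  have h0 : 0 ≤ inner ℝ (oneCone d : SymMat d) x := inner_nonneg_of_mem_cone (oneCone d).2 hx
  refine abs_le_of_sq_le_sq' ?_ h0 |>.2
  rw [norm_sq_eq_trace, inner_oneCone]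
  rw [trace_mul_self_eq' x]
  -- The `2 × 2` minors are nonnegative: the quadratic form at `s e_i + e_j` is a nonnegative
  -- polynomial in `s`, so its discriminant is at most `0`. Summing over `i, j` gives `‖x‖² ≤ (tr
  -- x)²`.
  have hq : ∀ i j, toMat x i j ^ 2 ≤ toMat x i i * toMat x j j := by
    intro i j
    have h : ∀ s : ℝ, 0 ≤ toMat x i i * (s * s) + 2 * toMat x i j * s + toMat x j j := by
      intro s
      have h := inner_nonneg_of_mem_cone (rankOne (s • Pi.single i 1 + Pi.single j 1)).2 hx
      rw [inner_rankOne] at h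
      simp only [Matrix.mulVec_add, add_dotProduct, dotProduct_add, Matrix.mulVec_smul,
        smul_dotProduct, dotProduct_smul, Matrix.mulVec_single_one,
        single_one_dotProduct, Matrix.col_apply, smul_eq_mul] at h
      have s1 := Matrix.IsSymm.apply (toMat_isSymm x) i j
      rw [s1] at h
      linarith
    have := discrim_le_zero h
    rw [discrim] at this
    linarith
  calc _ ≤ ∑ i, ∑ j, toMat x i i * toMat x j j :=
        Finset.sum_le_sum fun i _ => Finset.sum_le_sum fun j _ => hq i j
    _ = _ := by rw [sq, Matrix.trace, Finset.sum_mul_sum]; rfl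


/-! ### Laplace transforms of measures on the cone -/

/-- The exponential function `exp (-⟨u, ·⟩)` on the cone. -/
noncomputable def laplaceFun (u : Cone d) : BoundedContinuousFunction (Cone d) ℝ :=
  BoundedContinuousFunction.ofNormedAddCommGroup
    (fun y : Cone d => Real.exp (-inner ℝ (u : SymMat d) (y : SymMat d))) (by fun_prop) 1
    fun y => by
      rw [Real.norm_eq_abs, Real.abs_exp]
      exact Real.exp_le_one_iff.2 (neg_nonpos.2 (inner_nonneg_of_mem_cone u.2 y.2))

@[simp] theorem laplaceFun_apply (u y : Cone d) :
    laplaceFun u y = Real.exp (-inner ℝ (u : SymMat d) (y : SymMat d)) := rfl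

/-- The exponential functions form a multiplicative monoid. -/
noncomputable def laplaceMonoid (d : ℕ) : Submonoid (BoundedContinuousFunction (Cone d) ℝ) where
  carrier := range laplaceFun
  one_mem' := ⟨⟨0, zero_mem_cone⟩, by ext y; simp⟩
  mul_mem' := by
    rintro _ _ ⟨u, rfl⟩ ⟨v, rfl⟩
    refine ⟨⟨u + v, add_mem_cone u.2 v.2⟩, ?_⟩
    ext y
    simp only [laplaceFun_apply, BoundedContinuousFunction.coe_mul, Pi.mul_apply, ← Real.exp_add,
      inner_add_left]
    ring_nf

/-- A finite measure on the cone is determined by its Laplace transform. -/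
theorem ext_of_laplace {P Q : Measure (Cone d)} [IsFiniteMeasure P] [IsFiniteMeasure Q]
    (h : ∀ u : Cone d, ∫ y, laplaceFun u y ∂P = ∫ y, laplaceFun u y ∂Q) : P = Q := by
  let A : StarSubalgebra ℝ (BoundedContinuousFunction (Cone d) ℝ) :=
    { Algebra.adjoin ℝ (laplaceMonoid d : Set (BoundedContinuousFunction (Cone d) ℝ)) with
      star_mem' := fun {a} ha => by
        have : star a = a := by ext y; simp
        rwa [this] }
  -- The exponentials are closed under products, so the algebra they generate is just their linear
  -- span, on which equality of integrals follows by linearity.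
  have hmem : ∀ g, g ∈ A ↔
      g ∈ Submodule.span ℝ (laplaceMonoid d : Set (BoundedContinuousFunction (Cone d) ℝ)) := by
    intro g
    have := Algebra.adjoin_eq_span ℝ
      (laplaceMonoid d : Set (BoundedContinuousFunction (Cone d) ℝ))
    rw [Submonoid.closure_eq] at this
    rw [← this]
    rfl
  refine ext_of_forall_mem_subalgebra_integral_eq_of_polish (𝕜 := ℝ) (A := A) ?_ ?_
  · intro x y hxy
    by_contra hcon
    push Not at hcon
    refine hxy (Subtype.ext (ext_inner_cone fun u => ?_))
    have := hcon (laplaceFun u) ⟨_, ⟨laplaceFun u, (hmem _).2 (Submodule.subset_span ⟨u, rfl⟩), rfl⟩,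
      rfl⟩
    simpa using this
  · intro g hg
    rw [hmem] at hg
    induction hg using Submodule.span_induction with
    | mem g hg => obtain ⟨u, rfl⟩ := hg; exact h u
    | zero => simp
    | add f g _ _ hf hg =>
      simp only [BoundedContinuousFunction.coe_add, Pi.add_apply]
      rw [integral_add (f.integrable P) (g.integrable P),
        integral_add (f.integrable Q) (g.integrable Q), hf, hg]
    | smul c f _ hf =>
      simp only [BoundedContinuousFunction.coe_smul, integral_const_mul, smul_eq_mul, hf]

end AffinePSD

namespace AffinePSD
variable {d : ℕ}

/-! ### Integrability against the jump measures -/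

theorem exp_neg_sub_one_abs_le {s : ℝ} (hs : 0 ≤ s) : |Real.exp (-s) - 1| ≤ s := by
  have h1 := Real.add_one_le_exp (-s)
  have h2 := Real.exp_le_one_iff.2 (neg_nonpos.2 hs)
  rw [abs_of_nonpos (by linarith)]
  linarith

/-- The linear bound supplies an integrable majorant when only first moments exist; the quadratic
one gives the pointwise limit. -/
theorem exp_neg_sub_one_add_abs_le {s : ℝ} (hs : 0 ≤ s) :
    |Real.exp (-s) - 1 + s| ≤ s ∧ |Real.exp (-s) - 1 + s| ≤ s ^ 2 := by
  have h1 := Real.add_one_le_exp (-s)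
  have h2 := Real.exp_le_one_iff.2 (neg_nonpos.2 hs)
  rw [abs_of_nonneg (by linarith)]
  refine ⟨by linarith, ?_⟩
  have h3 := Real.add_one_le_exp s
  have h4 : Real.exp (-s) * Real.exp s = 1 := by rw [← Real.exp_add]; simp
  nlinarith [Real.exp_pos (-s), sq_nonneg s]

theorem integrable_exp_neg_inner_sub_one {ν : Measure (PuncturedCone d)}
    (hν : Integrable (fun ξ : PuncturedCone d => (ξ : SymMat d)) ν) {u : SymMat d}
    (hu : u ∈ cone d) :
    Integrable (fun ξ : PuncturedCone d => Real.exp (-inner ℝ u (ξ : SymMat d)) - 1) ν := by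
  refine (hν.norm.const_mul ‖u‖).mono (by fun_prop) (ae_of_all _ fun ξ => ?_)
  rw [Real.norm_eq_abs, Real.norm_of_nonneg (by positivity)]
  exact (exp_neg_sub_one_abs_le (inner_nonneg_of_mem_cone hu ξ.2.1)).trans
    (real_inner_le_norm _ _)

/-- The jump part of the Riccati vector field is differentiable at the origin within the cone. -/
theorem hasFDerivWithinAt_integral_exp {ν : Measure (PuncturedCone d)}
    (hν : Integrable (fun ξ : PuncturedCone d => (ξ : SymMat d)) ν) :
    HasFDerivWithinAt
      (fun u : SymMat d => ∫ ξ, (Real.exp (-inner ℝ u (ξ : SymMat d)) - 1) ∂ν)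
      (-innerSL ℝ (∫ ξ, (ξ : SymMat d) ∂ν)) (cone d) 0 := by
  rw [hasFDerivWithinAt_iff_tendsto]
  -- Dominated convergence for the normalized remainder. A direct quadratic estimate would need a
  -- second moment of `ν`, which is not available.
  have key : Tendsto (fun u : SymMat d =>
      ∫ ξ : PuncturedCone d, ‖u‖⁻¹ * |Real.exp (-inner ℝ u (ξ : SymMat d)) - 1
        + inner ℝ u (ξ : SymMat d)| ∂ν) (𝓝[cone d] 0) (𝓝 (∫ _, (0 : ℝ) ∂ν)) := by
    refine tendsto_integral_filter_of_dominated_convergence (fun ξ => ‖(ξ : SymMat d)‖)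
      (Eventually.of_forall fun u => by fun_prop) ?_ hν.norm (ae_of_all _ fun ξ => ?_)
    · filter_upwards [self_mem_nhdsWithin] with u hu
      refine ae_of_all _ fun ξ => ?_
      rw [Real.norm_of_nonneg (by positivity)]
      have h := (exp_neg_sub_one_add_abs_le (inner_nonneg_of_mem_cone hu ξ.2.1)).1.trans
        (real_inner_le_norm _ _)
      rcases eq_or_ne u 0 with rfl | h0
      · simp
      · rw [inv_mul_le_iff₀ (norm_pos_iff.2 h0)]
        exact h
    · have h1 : Tendsto (fun u : SymMat d => ‖u‖ * ‖(ξ : SymMat d)‖ ^ 2) (𝓝[cone d] 0) (𝓝 0) := by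
        have : Continuous fun u : SymMat d => ‖u‖ * ‖(ξ : SymMat d)‖ ^ 2 := by fun_prop
        simpa using (this.tendsto 0).mono_left nhdsWithin_le_nhds
      refine squeeze_zero' (Eventually.of_forall fun u => by positivity) ?_ h1
      filter_upwards [self_mem_nhdsWithin] with u hu
      have h0 := inner_nonneg_of_mem_cone hu ξ.2.1
      have h := (exp_neg_sub_one_add_abs_le h0).2
      have h' : (inner ℝ u (ξ : SymMat d)) ^ 2 ≤ (‖u‖ * ‖(ξ : SymMat d)‖) ^ 2 := by
        gcongr
        exact real_inner_le_norm _ _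
      rcases eq_or_ne u 0 with rfl | h0
      · simp
      · rw [inv_mul_le_iff₀ (norm_pos_iff.2 h0)]
        refine h.trans (h'.trans (le_of_eq (by ring)))
  simp only [integral_zero] at key
  refine squeeze_zero' (Eventually.of_forall fun u => by positivity) ?_ key
  filter_upwards [self_mem_nhdsWithin] with u hu
  have hi := integrable_exp_neg_inner_sub_one hν hu
  have hj : Integrable (fun ξ : PuncturedCone d => inner ℝ u (ξ : SymMat d)) ν :=
    hν.const_inner u
  rw [integral_const_mul]
  simp only [sub_zero, inner_zero_left, neg_zero, Real.exp_zero, sub_self, integral_zero,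
    _root_.neg_apply, innerSL_apply_apply, sub_neg_eq_add]
  gcongr
  rw [real_inner_comm, ← integral_inner hν, ← integral_add hi hj]
  exact norm_integral_le_integral_norm _

/-! ### Integrals against the cone-valued measure -/

namespace ConeMeasure

variable (μ : ConeMeasure d)

theorem pairing_apply_eq_tsum (u : Cone d) {A : Set (PuncturedCone d)} (hA : MeasurableSet A) :
    μ.pairing u A =
      ∑' n, ENNReal.ofReal (inner ℝ (u : SymMat d) (μ.toFun (A ∩ shell d n))) := by
  rw [pairing, Measure.sum_apply _ hA]
  exact tsum_congr fun n => Measure.ofMeasurable_apply A hA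

theorem toFun_inter_shell_mem {A : Set (PuncturedCone d)} (hA : MeasurableSet A) (n : ℕ) :
    μ.toFun (A ∩ shell d n) ∈ cone d :=
  μ.mem_cone _ (hA.inter (measurableSet_shell n))
    ((awayFromZero_shell n).mono Set.inter_subset_right)

/-- On each shell Cauchy–Schwarz applies and the norm of `μ(A)` is at most its trace. This carries
the first moment of `tr(μ)` over to every pairing. -/
theorem pairing_le (u : Cone d) :
    μ.pairing u ≤ ENNReal.ofReal ‖(u : SymMat d)‖ • μ.traceMeasure := by
  refine Measure.le_iff.2 fun A hA => ?_
  rw [Measure.smul_apply, traceMeasure, pairing_apply_eq_tsum μ _ hA, pairing_apply_eq_tsum μ _ hA,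
    smul_eq_mul, ← ENNReal.tsum_mul_left]
  refine ENNReal.tsum_le_tsum fun n => ?_
  rw [← ENNReal.ofReal_mul (norm_nonneg _)]
  refine ENNReal.ofReal_le_ofReal ((real_inner_le_norm _ _).trans ?_)
  gcongr
  exact norm_le_inner_oneCone (μ.toFun_inter_shell_mem hA n)

theorem pairing_smul {u w : Cone d} {c : ℝ} (hc : 0 ≤ c) (h : (w : SymMat d) = c • (u : SymMat d)) :
    μ.pairing w = ENNReal.ofReal c • μ.pairing u := by
  refine Measure.ext fun A hA => ?_
  rw [Measure.smul_apply, pairing_apply_eq_tsum μ _ hA, pairing_apply_eq_tsum μ _ hA,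
    smul_eq_mul, ← ENNReal.tsum_mul_left]
  refine tsum_congr fun n => ?_
  rw [h, real_inner_smul_left, ENNReal.ofReal_mul hc]

theorem integrable_pairing (h : ∫⁻ ξ, ‖(ξ : SymMat d)‖ₑ ∂μ.traceMeasure < ∞) (u : Cone d) :
    Integrable (fun ξ : PuncturedCone d => (ξ : SymMat d)) (μ.pairing u) := by
  have h0 : Integrable (fun ξ : PuncturedCone d => (ξ : SymMat d)) μ.traceMeasure :=
    ⟨by fun_prop, h⟩
  exact (h0.smul_measure ENNReal.ofReal_ne_top).mono_measure (μ.pairing_le u)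

/-- For `i = j` the vector `e_i + e_j` is `2 e_i`, whose rank-one matrix carries weight `4`, and `(4
- 1 - 1) / 2 = 1`. -/
theorem entryIntegral_self (i : Fin d) (g : PuncturedCone d → ℝ) :
    μ.entryIntegral i i g = ∫ ξ, g ξ ∂(μ.pairing (rankOne (Pi.single i 1))) := by
  have h : ((rankOne (Pi.single i 1 + Pi.single i 1) : Cone d) : SymMat d) =
      (4 : ℝ) • (rankOne (Pi.single i 1) : SymMat d) := by
    apply toMat_injective
    rw [map_smul]
    change Matrix.vecMulVec _ _ = (4 : ℝ) • Matrix.vecMulVec _ _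
    ext k l
    simp only [Matrix.vecMulVec_apply, Matrix.smul_apply, Pi.add_apply, smul_eq_mul]
    ring
  rw [entryIntegral, μ.pairing_smul (by norm_num) h, integral_smul_measure,
    ENNReal.toReal_ofReal (by norm_num)]
  simp only [smul_eq_mul]
  ring

theorem inner_oneCone_integral (g : PuncturedCone d → ℝ) :
    inner ℝ (oneCone d : SymMat d) (μ.integral g) =
      ∑ i, ∫ ξ, g ξ ∂(μ.pairing (rankOne (Pi.single i 1))) := by
  rw [inner_oneCone]
  exact Finset.sum_congr rfl fun i _ => μ.entryIntegral_self i g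

end ConeMeasure

/-- The symmetrized matrix unit. -/
noncomputable def symUnit (i j : Fin d) : SymMat d :=
  ofSymm ((1 / 2 : ℝ) • (Matrix.single i j 1 + Matrix.single j i 1)) (by
    rw [Matrix.IsSymm, Matrix.transpose_smul, Matrix.transpose_add, Matrix.transpose_single,
      Matrix.transpose_single, add_comm])

theorem inner_symUnit (i j : Fin d) (x : SymMat d) : inner ℝ (symUnit i j) x = toMat x i j := by
  rw [inner_eq_trace, symUnit, toMat_ofSymm, Matrix.smul_mul, Matrix.trace_smul, add_mul,
    Matrix.trace_add, Matrix.trace_single_mul, Matrix.trace_single_mul,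
    Matrix.IsSymm.apply (toMat_isSymm x) i j]
  simp
  ring

theorem inner_eq_sum (x y : SymMat d) : inner ℝ x y = ∑ i, ∑ j, toMat x i j * toMat y i j := by
  rw [inner_eq_trace, Matrix.trace]
  refine Finset.sum_congr rfl fun i _ => ?_
  rw [Matrix.diag_apply, Matrix.mul_apply]
  exact Finset.sum_congr rfl fun j _ => by rw [Matrix.IsSymm.apply (toMat_isSymm y) i j]

theorem eq_sum_symUnit (x : SymMat d) : x = ∑ i, ∑ j, toMat x i j • symUnit i j := by
  refine ext_inner_right ℝ fun y => ?_
  simp only [sum_inner, real_inner_smul_left, inner_symUnit, inner_eq_sum x y]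

/-- An entry, as a continuous linear functional. -/
noncomputable def entryL (i j : Fin d) : SymMat d →L[ℝ] ℝ := innerSL ℝ (symUnit i j)

theorem entryL_apply (i j : Fin d) (x : SymMat d) : entryL i j x = toMat x i j := by
  rw [entryL, innerSL_apply_apply, inner_symUnit]

/-- The map is quadratic in `u`; in coordinates it is a sum of products of two linear forms, both
vanishing at the origin. -/
theorem hasFDerivAt_sandwich (α : SymMat d) :
    HasFDerivAt (fun u : SymMat d => AdmissibleParameters.sandwich u α)
      (0 : SymMat d →L[ℝ] SymMat d) 0 := by
  have h : (fun u : SymMat d => AdmissibleParameters.sandwich u α) = fun u => ∑ i, ∑ j,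
      (∑ k, (∑ l, entryL i l u * toMat α l k) * entryL k j u) • symUnit i j := by
    ext1 u
    have e : toMat (AdmissibleParameters.sandwich u α) = toMat u * toMat α * toMat u := rfl
    rw [eq_sum_symUnit (AdmissibleParameters.sandwich u α), e]
    simp only [Matrix.mul_apply, entryL_apply]
  have h1 : ∀ i j, HasFDerivAt (fun u : SymMat d =>
      (∑ k, (∑ l, entryL i l u * toMat α l k) * entryL k j u) • symUnit i j)
      (0 : SymMat d →L[ℝ] SymMat d) 0 := by
    intro i j
    have h2 : HasFDerivAt (fun u : SymMat d =>
        ∑ k, (∑ l, entryL i l u * toMat α l k) * entryL k j u) (0 : SymMat d →L[ℝ] ℝ) 0 := by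
      have h3 : ∀ k, HasFDerivAt (fun u : SymMat d =>
          (∑ l, entryL i l u * toMat α l k) * entryL k j u) (0 : SymMat d →L[ℝ] ℝ) 0 := by
        intro k
        have h4 : HasFDerivAt (fun u : SymMat d => ∑ l, entryL i l u * toMat α l k)
            (∑ l, toMat α l k • entryL i l) 0 :=
          HasFDerivAt.fun_sum fun l _ => (entryL i l).hasFDerivAt.mul_const _
        have h5 := h4.mul (entryL k j).hasFDerivAt
        refine h5.congr_fderiv ?_
        ext1 v
        simp
      simpa using HasFDerivAt.fun_sum fun k (_ : k ∈ Finset.univ) => h3 k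
    simpa using h2.smul_const (symUnit i j)
  rw [h]
  simpa using HasFDerivAt.fun_sum fun i (_ : i ∈ Finset.univ) =>
    HasFDerivAt.fun_sum fun j (_ : j ∈ Finset.univ) => h1 i j

theorem sandwich_mem_cone {u α : SymMat d} (hα : α ∈ cone d) :
    AdmissibleParameters.sandwich u α ∈ cone d := by
  have hα' : (toMat α).PosSemidef := hα
  have h := hα'.mul_mul_conjTranspose_same (toMat u)
  rwa [Matrix.conjTranspose_eq_transpose_of_trivial, (toMat_isSymm u).eq] at h

namespace ConeMeasure

variable (μ : ConeMeasure d)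

theorem integral_eq_sum (g : PuncturedCone d → ℝ) :
    μ.integral g = ∑ i, ∑ j, μ.entryIntegral i j g • symUnit i j :=
  eq_sum_symUnit _

theorem adjoint_meanJump_apply (v : SymMat d) :
    ContinuousLinearMap.adjoint μ.meanJump v = ∑ i, ∑ j,
      inner ℝ (μ.entryIntegral i j fun ξ => (ξ : SymMat d)) v • symUnit i j := by
  refine ext_inner_right ℝ fun x => ?_
  rw [ContinuousLinearMap.adjoint_inner_left, meanJump_apply]
  simp only [inner_sum, sum_inner, real_inner_smul_left, real_inner_smul_right, inner_symUnit]
  refine Finset.sum_congr rfl fun i _ => Finset.sum_congr rfl fun j _ => ?_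
  rw [real_inner_comm, mul_comm]

/-- Each entry integral is a combination of three integrals against positive measures, which are
differentiated separately; reassembling the entries gives the adjoint of the mean jump map. -/
theorem hasFDerivWithinAt_integral (h : ∫⁻ ξ, ‖(ξ : SymMat d)‖ₑ ∂μ.traceMeasure < ∞) :
    HasFDerivWithinAt
      (fun u : SymMat d => μ.integral fun ξ => Real.exp (-inner ℝ u (ξ : SymMat d)) - 1)
      (-ContinuousLinearMap.adjoint μ.meanJump) (cone d) 0 := by
  simp only [integral_eq_sum]
  have h1 : ∀ i j, HasFDerivWithinAt (fun u : SymMat d =>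
      μ.entryIntegral i j (fun ξ => Real.exp (-inner ℝ u (ξ : SymMat d)) - 1))
      (-innerSL ℝ (μ.entryIntegral i j fun ξ => (ξ : SymMat d))) (cone d) 0 := by
    intro i j
    have a := fun w => hasFDerivWithinAt_integral_exp (μ.integrable_pairing h w)
    have b := (((a (rankOne (Pi.single i 1 + Pi.single j 1))).sub
      (a (rankOne (Pi.single i 1)))).sub (a (rankOne (Pi.single j 1)))).const_smul (1 / 2 : ℝ)
    refine b.congr_fderiv ?_
    ext v
    simp only [entryIntegral, _root_.smul_apply, _root_.sub_apply,
      _root_.neg_apply, innerSL_apply_apply, inner_sub_left, real_inner_smul_left, smul_eq_mul]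
    ring
  have h2 := HasFDerivWithinAt.fun_sum fun i (_ : i ∈ Finset.univ) =>
    HasFDerivWithinAt.fun_sum fun j (_ : j ∈ Finset.univ) => (h1 i j).smul_const (symUnit i j)
  refine h2.congr_fderiv ?_
  ext1 v
  simp [adjoint_meanJump_apply]

end ConeMeasure

/-! ### The Riccati fields: derivative at the origin and growth -/

namespace AdmissibleParameters

variable (P : AdmissibleParameters d)

/-- The diffusion term is of second order, and the jump term contributes its first moment; this is
how the effective drift enters. -/
theorem hasFDerivWithinAt_R :
    HasFDerivWithinAt P.R (ContinuousLinearMap.adjoint P.effectiveDrift) (cone d) 0 := by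
  have h1 := ((hasFDerivAt_sandwich P.α).const_smul (2 : ℝ)).neg.hasFDerivWithinAt (s := cone d)
  have h2 := (ContinuousLinearMap.adjoint P.B).hasFDerivWithinAt (s := cone d) (x := 0)
  have h3 := P.μ.hasFDerivWithinAt_integral P.μ_moment
  refine ((h1.add h2).sub h3).congr_fderiv ?_
  simp [effectiveDrift]

theorem R_zero : P.R 0 = 0 := by
  have : sandwich (0 : SymMat d) P.α = 0 := by
    apply toMat_injective
    simp [sandwich]
  simp [R, this, ConeMeasure.integral_eq_sum, ConeMeasure.entryIntegral]

theorem hasFDerivWithinAt_F (hm : Integrable (fun ξ : PuncturedCone d => (ξ : SymMat d)) P.m) :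
    HasFDerivWithinAt P.F (innerSL ℝ (P.b + ∫ ξ : PuncturedCone d, (ξ : SymMat d) ∂P.m))
      (cone d) 0 := by
  have h1 := (innerSL ℝ P.b).hasFDerivWithinAt (s := cone d) (x := 0)
  refine (h1.sub (hasFDerivWithinAt_integral_exp hm)).congr_fderiv ?_
  simp

theorem F_zero : P.F 0 = 0 := by simp [F]

theorem F_nonneg {u : SymMat d} (hu : u ∈ cone d) : 0 ≤ P.F u := by
  refine sub_nonneg.2 (le_trans (integral_nonpos fun ξ => ?_) (inner_nonneg_of_mem_cone P.b_mem hu))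
  have := Real.exp_le_one_iff.2 (neg_nonpos.2 (inner_nonneg_of_mem_cone hu ξ.2.1))
  simpa using this

/-- The trace of the Riccati vector field grows at most linearly on the cone. -/
theorem exists_inner_oneCone_R_le : ∃ K : ℝ, 0 ≤ K ∧ ∀ v ∈ cone d,
    inner ℝ (oneCone d : SymMat d) (P.R v) ≤ K * inner ℝ (oneCone d : SymMat d) v := by
  let ν : Fin d → Measure (PuncturedCone d) := fun i => P.μ.pairing (rankOne (Pi.single i 1))
  have hν : ∀ i, Integrable (fun ξ : PuncturedCone d => (ξ : SymMat d)) (ν i) := fun i =>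
    P.μ.integrable_pairing P.μ_moment _
  have hK : 0 ≤ ‖P.B (oneCone d)‖ + ∑ i, ∫ ξ, ‖(ξ : SymMat d)‖ ∂ν i :=
    add_nonneg (norm_nonneg _)
      (Finset.sum_nonneg fun i _ => integral_nonneg fun ξ => norm_nonneg _)
  refine ⟨_, hK, fun v hv => ?_⟩
  refine le_trans ?_ (mul_le_mul_of_nonneg_left (norm_le_inner_oneCone hv) hK)
  rw [R, inner_sub_right, inner_add_right, inner_neg_right, real_inner_smul_right,
    ContinuousLinearMap.adjoint_inner_right, ConeMeasure.inner_oneCone_integral]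
  -- The quadratic term has a favourable sign and is dropped; the remaining terms grow linearly.
  have h1 := inner_nonneg_of_mem_cone (oneCone d).2 (sandwich_mem_cone (u := v) P.α_mem)
  have h2 := real_inner_le_norm (P.B (oneCone d)) v
  have h3 : -∑ i, ∫ ξ, (Real.exp (-inner ℝ v (ξ : SymMat d)) - 1) ∂ν i ≤
      (∑ i, ∫ ξ, ‖(ξ : SymMat d)‖ ∂ν i) * ‖v‖ := by
    rw [← Finset.sum_neg_distrib, Finset.sum_mul]
    refine Finset.sum_le_sum fun i _ => ?_
    rw [← integral_neg, ← integral_mul_const]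
    refine integral_mono (integrable_exp_neg_inner_sub_one (hν i) hv).neg
      ((hν i).norm.mul_const _) fun ξ => ?_
    refine (neg_le_abs _).trans ((exp_neg_sub_one_abs_le
      (inner_nonneg_of_mem_cone hv ξ.2.1)).trans ?_)
    rw [mul_comm]
    exact real_inner_le_norm _ _
  change -(2 * _) + _ - ∑ i, ∫ ξ, (Real.exp (-inner ℝ v (ξ : SymMat d)) - 1) ∂ν i ≤ _
  linarith

theorem integrable_m (hm : ∫⁻ ξ in {ξ : PuncturedCone d | 1 < ‖(ξ : SymMat d)‖},
    ‖(ξ : SymMat d)‖ₑ ∂P.m < ∞) :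
    Integrable (fun ξ : PuncturedCone d => (ξ : SymMat d)) P.m := by
  refine ⟨by fun_prop, ?_⟩
  have hs : MeasurableSet {ξ : PuncturedCone d | 1 < ‖(ξ : SymMat d)‖} :=
    measurableSet_lt measurable_const (by fun_prop)
  rw [HasFiniteIntegral, ← lintegral_add_compl _ hs]
  refine ENNReal.add_lt_top.2 ⟨hm, lt_of_le_of_lt ?_ P.m_small⟩
  refine le_trans (setLIntegral_mono_ae' hs.compl (ae_of_all _ fun ξ hξ => ?_))
    (setLIntegral_le_lintegral _ _)
  have : ‖(ξ : SymMat d)‖ ≤ 1 := not_lt.1 hξ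
  rw [min_eq_left this, ofReal_norm]

end AdmissibleParameters

end AffinePSD

/-! ### Continuity and inverses of operator exponentials -/

section ExpDerivative

variable {E : Type*} [NormedAddCommGroup E] [NormedSpace ℝ E] [CompleteSpace E]

theorem ContinuousLinearMap.continuous_exp_smul (T : E →L[ℝ] E) :
    Continuous fun t : ℝ => NormedSpace.exp (t • T) := by
  let : NormedAlgebra ℚ (E →L[ℝ] E) := NormedAlgebra.restrictScalars ℚ ℝ _
  exact NormedSpace.exp_continuous.comp (continuous_id.smul continuous_const)

theorem ContinuousLinearMap.exp_smul_apply_exp_neg_smul (T : E →L[ℝ] E) (t : ℝ) (x : E) :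
    NormedSpace.exp (t • T) (NormedSpace.exp (t • -T) x) = x := by
  let : NormedAlgebra ℚ (E →L[ℝ] E) := NormedAlgebra.restrictScalars ℚ ℝ _
  rw [← mul_apply_eq_comp, ← NormedSpace.exp_add_of_commute]
  · simp
  · exact ((Commute.refl T).neg_right.smul_right t).smul_left t

end ExpDerivative

namespace AffinePSD
variable {d : ℕ}

/-- Multiplication of an element of the cone by a nonnegative number. -/
noncomputable def coneSMul (c : ℝ≥0) (u : Cone d) : Cone d := ⟨(c : ℝ) • (u : SymMat d), smul_mem_cone u.2 c.2⟩

@[simp] theorem coe_coneSMul (c : ℝ≥0) (u : Cone d) :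
    (coneSMul c u : SymMat d) = (c : ℝ) • (u : SymMat d) := rfl

theorem inner_exp_smul_adjoint (T : SymMat d →L[ℝ] SymMat d) (t : ℝ) (u x : SymMat d) :
    inner ℝ (NormedSpace.exp (t • ContinuousLinearMap.adjoint T) u) x =
      inner ℝ u (NormedSpace.exp (t • T) x) := by
  have h : NormedSpace.exp (t • ContinuousLinearMap.adjoint T) =
      ContinuousLinearMap.adjoint (NormedSpace.exp (t • T)) := by
    let : NormedAlgebra ℚ (SymMat d →L[ℝ] SymMat d) := NormedAlgebra.restrictScalars ℚ ℝ _
    rw [← ContinuousLinearMap.star_eq_adjoint, ← ContinuousLinearMap.star_eq_adjoint,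
      NormedSpace.star_exp, star_smul, star_trivial t]
  rw [h, ContinuousLinearMap.adjoint_inner_left]

namespace AdmissibleParameters

variable (P : AdmissibleParameters d)

/-- The mean contribution of the constant characteristics up to time `t`. -/
noncomputable def meanImmigration (t : ℝ) : SymMat d :=
  ∫ s in (0 : ℝ)..t, NormedSpace.exp (s • P.effectiveDrift)
    (P.b + ∫ ξ : PuncturedCone d, (ξ : SymMat d) ∂P.m)

theorem hasDerivAt_meanImmigration (t : ℝ) :
    HasDerivAt P.meanImmigration (NormedSpace.exp (t • P.effectiveDrift)
      (P.b + ∫ ξ : PuncturedCone d, (ξ : SymMat d) ∂P.m)) t := by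
  have hc : Continuous fun s : ℝ => NormedSpace.exp (s • P.effectiveDrift)
      (P.b + ∫ ξ : PuncturedCone d, (ξ : SymMat d) ∂P.m) :=
    (ContinuousLinearMap.continuous_exp_smul _).clm_apply continuous_const
  exact intervalIntegral.integral_hasDerivAt_right (hc.intervalIntegrable _ _)
    (hc.stronglyMeasurableAtFilter _ _) hc.continuousAt

theorem meanImmigration_zero : P.meanImmigration 0 = 0 := intervalIntegral.integral_same

/-! ### Linearization of the Riccati flow at the origin -/

namespace IsRiccatiSolution

variable {P} {φ : ℝ → Cone d → ℝ} {ψ : ℝ → Cone d → Cone d}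

/-- Grönwall: `exp(-Kt) tr ψ(t, u)` is nonincreasing. The bound is linear in `u`, so small initial
values stay small on bounded time intervals. -/
theorem exists_norm_le (h : P.IsRiccatiSolution φ ψ) : ∃ K : ℝ, 0 ≤ K ∧ ∀ u : Cone d, ∀ t : ℝ,
    0 ≤ t → ‖(ψ t u : SymMat d)‖ ≤ Real.exp (K * t) * inner ℝ (oneCone d : SymMat d) u := by
  obtain ⟨K, hK, hR⟩ := P.exists_inner_oneCone_R_le
  refine ⟨K, hK, fun u t ht => (norm_le_inner_oneCone (ψ t u).2).trans ?_⟩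
  obtain ⟨-, h0, hd⟩ := h u
  let f : ℝ → ℝ := fun s => Real.exp (-(K * s)) * inner ℝ (oneCone d : SymMat d) (ψ s u : SymMat d)
  have hf : ∀ s, 0 ≤ s → HasDerivWithinAt f
      (Real.exp (-(K * s)) * (-K) * inner ℝ (oneCone d : SymMat d) (ψ s u : SymMat d) +
        Real.exp (-(K * s)) * inner ℝ (oneCone d : SymMat d) (P.R (ψ s u))) (Ici 0) s := by
    intro s hs
    have h1 : HasDerivAt (fun s : ℝ => Real.exp (-(K * s))) (Real.exp (-(K * s)) * (-K)) s := by
      simpa using ((hasDerivAt_id s).const_mul K).neg.exp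
    exact h1.hasDerivWithinAt.mul
      ((innerSL ℝ (oneCone d : SymMat d)).hasFDerivAt.comp_hasDerivWithinAt s (hd s hs).2)
  have hanti : AntitoneOn f (Ici 0) := by
    refine antitoneOn_of_hasDerivWithinAt_nonpos (convex_Ici 0)
      (fun s hs => (hf s hs).continuousWithinAt)
      (fun s hs => (hf s (interior_subset hs)).mono interior_subset) fun s hs => ?_
    have := mul_le_mul_of_nonneg_left (hR _ (ψ s u).2) (Real.exp_pos (-(K * s))).le
    linarith
  have := hanti (mem_Ici.2 le_rfl) (mem_Ici.2 ht) ht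
  simp only [f, h0, mul_zero, Real.exp_zero, Real.exp_neg] at this
  rwa [inv_mul_le_iff₀ (Real.exp_pos _), inv_one, one_mul] at this

theorem exists_norm_coneSMul_le (h : P.IsRiccatiSolution φ ψ) (u : Cone d) (T : ℝ) :
    ∃ C : ℝ, 0 ≤ C ∧ ∀ ε : ℝ≥0, ∀ t ∈ Icc 0 T, ‖(ψ t (coneSMul ε u) : SymMat d)‖ ≤ C * ε := by
  obtain ⟨K, hK, hψ⟩ := h.exists_norm_le
  have hq0 : 0 ≤ inner ℝ (oneCone d : SymMat d) (u : SymMat d) :=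
    inner_nonneg_of_mem_cone (oneCone d).2 u.2
  refine ⟨Real.exp (K * T) * inner ℝ (oneCone d : SymMat d) (u : SymMat d), by positivity,
    fun ε t ht => (hψ (coneSMul ε u) t ht.1).trans ?_⟩
  rw [coe_coneSMul, real_inner_smul_right, mul_assoc, mul_comm _ (ε : ℝ)]
  have := Real.exp_le_exp.2 (mul_le_mul_of_nonneg_left ht.2 hK)
  gcongr

/-- Linearization of the solution `ψ` at the origin, locally uniformly in time. -/
theorem linearize_psi (h : P.IsRiccatiSolution φ ψ) (u : Cone d) {T : ℝ} (hT : 0 ≤ T) {η : ℝ}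
    (hη : 0 < η) : ∃ ε₀ : ℝ, 0 < ε₀ ∧ ∀ ε : ℝ≥0, (ε : ℝ) < ε₀ → ∀ t ∈ Icc 0 T,
      ‖(ψ t (coneSMul ε u) : SymMat d) - (ε : ℝ) •
        NormedSpace.exp (t • ContinuousLinearMap.adjoint P.effectiveDrift) (u : SymMat d)‖
        ≤ η * ε := by
  set A := ContinuousLinearMap.adjoint P.effectiveDrift with hA
  obtain ⟨C, hC0, hψC⟩ := h.exists_norm_coneSMul_le u T
  obtain ⟨M₁, hM₁⟩ := (isCompact_Icc (a := (0 : ℝ)) (b := T)).exists_bound_of_continuousOn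
    (ContinuousLinearMap.continuous_exp_smul A).continuousOn
  obtain ⟨M₂, hM₂⟩ := (isCompact_Icc (a := (0 : ℝ)) (b := T)).exists_bound_of_continuousOn
    (ContinuousLinearMap.continuous_exp_smul (-A)).continuousOn
  have hM₁0 : 0 ≤ M₁ := (norm_nonneg _).trans (hM₁ 0 ⟨le_rfl, hT⟩)
  have hM₂0 : 0 ≤ M₂ := (norm_nonneg _).trans (hM₂ 0 ⟨le_rfl, hT⟩)
  -- Tolerance for the remainder of `R`, matched to the final chain of estimates; the `+ 1` keeps
  -- the denominator positive.
  set c := η / (M₁ * M₂ * C * T + 1) with hc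
  have hc0 : 0 < c := by positivity
  have hR := (P.hasFDerivWithinAt_R).isLittleO.def hc0
  obtain ⟨δ, hδ, hRδ⟩ := Metric.mem_nhdsWithin_iff.1 hR
  refine ⟨δ / (C + 1), by positivity, fun ε hε t ht => ?_⟩
  rw [lt_div_iff₀ (by positivity)] at hε
  have hε0 : (0 : ℝ) ≤ ε := ε.2
  have hRψ : ∀ s ∈ Icc 0 T, ‖P.R (ψ s (coneSMul ε u)) - A (ψ s (coneSMul ε u))‖ ≤ c * (C * ε) := by
    intro s hs
    have h1 : (ψ s (coneSMul ε u) : SymMat d) ∈ Metric.ball 0 δ ∩ cone d := by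
      refine ⟨?_, (ψ s (coneSMul ε u)).2⟩
      rw [mem_ball_zero_iff]
      have := hψC ε s hs
      nlinarith
    have h2 := hRδ h1
    simp only [mem_ofPred_eq, R_zero, sub_zero] at h2
    exact h2.trans (mul_le_mul_of_nonneg_left (hψC ε s hs) hc0.le)
  obtain ⟨-, h0, hd⟩ := h (coneSMul ε u)
  -- Variation of constants: after conjugation by `exp(-sA)` only the nonlinear remainder `R(ψ) -
  -- Aψ` drives the motion.
  have hz : ∀ s ∈ Icc 0 t, HasDerivWithinAt
      (fun s => NormedSpace.exp (s • -A) (ψ s (coneSMul ε u) : SymMat d))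
      (NormedSpace.exp (s • -A) (P.R (ψ s (coneSMul ε u)) - A (ψ s (coneSMul ε u)))) (Icc 0 t) s := by
    intro s hs
    have h1 := (hasDerivAt_exp_smul_const (𝕂 := ℝ) (-A) s).hasDerivWithinAt (s := Icc 0 t)
    have h2 := ((hd s hs.1).2).mono (Icc_subset_Ici_self : Icc 0 t ⊆ Ici 0)
    convert h1.clm_apply h2 using 1
    rw [map_sub, mul_apply_eq_comp, _root_.neg_apply, map_neg]
    abel
  have hmv := norm_image_sub_le_of_norm_deriv_le_segment' hz (C := M₂ * (c * (C * ε))) (fun s hs =>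
    (ContinuousLinearMap.le_opNorm _ _).trans (mul_le_mul (hM₂ s ⟨hs.1, hs.2.le.trans ht.2⟩)
      (hRψ s ⟨hs.1, hs.2.le.trans ht.2⟩) (norm_nonneg _) hM₂0)) t ⟨ht.1, le_rfl⟩
  simp only [zero_smul, NormedSpace.exp_zero, one_apply_eq_self, h0, coe_coneSMul, sub_zero] at hmv
  have heq : (ψ t (coneSMul ε u) : SymMat d) - (ε : ℝ) • NormedSpace.exp (t • A) (u : SymMat d) =
      NormedSpace.exp (t • A) (NormedSpace.exp (t • -A) (ψ t (coneSMul ε u) : SymMat d) -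
        (ε : ℝ) • (u : SymMat d)) := by
    rw [map_sub, ContinuousLinearMap.exp_smul_apply_exp_neg_smul, map_smul]
  rw [heq]
  calc _ ≤ M₁ * (M₂ * (c * (C * ε)) * t) := (ContinuousLinearMap.le_opNorm _ _).trans
        (mul_le_mul (hM₁ t ht) hmv (norm_nonneg _) hM₁0)
    _ ≤ M₁ * (M₂ * (c * (C * ε)) * T) := by gcongr; exact ht.2
    _ = (M₁ * M₂ * C * T) * c * ε := by ring
    _ ≤ (M₁ * M₂ * C * T + 1) * c * ε := by gcongr; linarith
    _ = η * ε := by rw [hc]; field_simp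

/-- Linearization of the solution `φ` at the origin. -/
theorem linearize_phi (h : P.IsRiccatiSolution φ ψ)
    (hm : Integrable (fun ξ : PuncturedCone d => (ξ : SymMat d)) P.m) (u : Cone d) {T : ℝ}
    (hT : 0 ≤ T) {η : ℝ} (hη : 0 < η) : ∃ ε₀ : ℝ, 0 < ε₀ ∧ ∀ ε : ℝ≥0, (ε : ℝ) < ε₀ →
      |φ T (coneSMul ε u) - ε * inner ℝ (u : SymMat d) (P.meanImmigration T)| ≤ η * ε := by
  set A := ContinuousLinearMap.adjoint P.effectiveDrift with hA
  set β := P.b + ∫ ξ : PuncturedCone d, (ξ : SymMat d) ∂P.m with hβ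
  obtain ⟨C, hC0, hψC⟩ := h.exists_norm_coneSMul_le u T
  set c := η / (C * T + ‖β‖ * T + 1) with hc
  have hc0 : 0 < c := by positivity
  obtain ⟨δ, hδ, hFδ⟩ := Metric.mem_nhdsWithin_iff.1 ((P.hasFDerivWithinAt_F hm).isLittleO.def hc0)
  obtain ⟨ε₁, hε₁, hlin⟩ := h.linearize_psi u hT hc0
  refine ⟨min ε₁ (δ / (C + 1)), by positivity, fun ε hε => ?_⟩
  obtain ⟨hεa, hεb⟩ := lt_min_iff.1 hε
  rw [lt_div_iff₀ (by positivity)] at hεb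
  have hε0 : (0 : ℝ) ≤ ε := ε.2
  obtain ⟨h00, -, hd⟩ := h (coneSMul ε u)
  have hz : ∀ s ∈ Icc 0 T, HasDerivWithinAt
      (fun s => φ s (coneSMul ε u) - ε * inner ℝ (u : SymMat d) (P.meanImmigration s))
      (P.F (ψ s (coneSMul ε u)) - ε * inner ℝ (u : SymMat d)
        (NormedSpace.exp (s • P.effectiveDrift) β)) (Icc 0 T) s := by
    intro s hs
    have h1 := ((innerSL ℝ (u : SymMat d)).hasFDerivAt.comp_hasDerivAt s
      (P.hasDerivAt_meanImmigration s)).const_mul (ε : ℝ)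
    exact (((hd s hs.1).1).mono (Icc_subset_Ici_self : Icc 0 T ⊆ Ici 0)).sub h1.hasDerivWithinAt
  -- Two errors: the remainder of `F` at `ψ`, and `β` paired with the linearization error of `ψ`.
  have hb : ∀ s ∈ Ico 0 T, ‖P.F (ψ s (coneSMul ε u)) - ε * inner ℝ (u : SymMat d)
        (NormedSpace.exp (s • P.effectiveDrift) β)‖ ≤ c * (C * ε) + ‖β‖ * (c * ε) := by
    intro s hs
    have hs' : s ∈ Icc 0 T := ⟨hs.1, hs.2.le⟩
    have h1 : (ψ s (coneSMul ε u) : SymMat d) ∈ Metric.ball 0 δ ∩ cone d := by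
      refine ⟨?_, (ψ s (coneSMul ε u)).2⟩
      rw [mem_ball_zero_iff]
      have := hψC ε s hs'
      nlinarith
    have h2 := hFδ h1
    simp only [mem_ofPred_eq, F_zero, sub_zero, innerSL_apply_apply] at h2
    have h3 := h2.trans (mul_le_mul_of_nonneg_left (hψC ε s hs') hc0.le)
    have h4 := (norm_inner_le_norm (𝕜 := ℝ) β ((ψ s (coneSMul ε u) : SymMat d) -
      (ε : ℝ) • NormedSpace.exp (s • A) (u : SymMat d))).trans
      (mul_le_mul_of_nonneg_left (hlin ε hεa s hs') (norm_nonneg _))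
    refine le_trans (le_of_eq ?_) ((norm_add_le _ _).trans (add_le_add h3 h4))
    congr 1
    rw [inner_sub_right, real_inner_smul_right, real_inner_comm _ β, real_inner_comm _ β,
      inner_exp_smul_adjoint, real_inner_comm β]
    ring
  have hmv := norm_image_sub_le_of_norm_deriv_le_segment' hz hb T ⟨hT, le_rfl⟩
  simp only [h00, meanImmigration_zero, inner_zero_right, mul_zero, sub_zero] at hmv
  refine hmv.trans ?_
  calc _ = (C * T + ‖β‖ * T) * c * ε := by ring
    _ ≤ (C * T + ‖β‖ * T + 1) * c * ε := by nlinarith [mul_nonneg hc0.le hε0]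
    _ = η * ε := by rw [hc]; field_simp

end IsRiccatiSolution
end AdmissibleParameters
end AffinePSD

/-! ### First moments from Laplace transforms -/

section LaplaceMoments

/-- The null sequence `1 / (n + 1)`. -/
noncomputable def nullSeq (n : ℕ) : ℝ≥0 := 1 / ((n : ℝ≥0) + 1)

theorem nullSeq_pos (n : ℕ) : 0 < (nullSeq n : ℝ) := by
  rw [nullSeq]; positivity

theorem tendsto_nullSeq : Tendsto (fun n => (nullSeq n : ℝ)) atTop (𝓝 0) := by
  simpa [nullSeq] using tendsto_one_div_add_atTop_nhds_zero_nat (𝕜 := ℝ)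

theorem tendsto_one_sub_exp_neg_div {g : ℕ → ℝ} {L : ℝ} (hg : ∀ n, 0 ≤ g n)
    (h : Tendsto (fun n => g n / nullSeq n) atTop (𝓝 L)) :
    Tendsto (fun n => (1 - Real.exp (-g n)) / nullSeq n) atTop (𝓝 L) := by
  have h1 : Tendsto (fun n => (g n / nullSeq n) * (g n / nullSeq n) * nullSeq n) atTop (𝓝 0) := by
    simpa using (h.mul h).mul tendsto_nullSeq
  have h2 : Tendsto (fun n => (Real.exp (-g n) - 1 + g n) / nullSeq n) atTop (𝓝 0) := by
    refine squeeze_zero_norm (fun n => ?_) h1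
    have hn := nullSeq_pos n
    rw [norm_div, Real.norm_of_nonneg hn.le, Real.norm_eq_abs]
    refine (div_le_div_of_nonneg_right (AffinePSD.exp_neg_sub_one_add_abs_le (hg n)).2 hn.le).trans
      (le_of_eq ?_)
    field_simp
  have h3 := h.sub h2
  rw [sub_zero] at h3
  refine h3.congr fun n => ?_
  ring

theorem tendsto_pointwise_laplace_quotient {y : ℝ} (hy : 0 ≤ y) :
    Tendsto (fun n => (1 - Real.exp (-(nullSeq n * y))) / nullSeq n) atTop (𝓝 y) := by
  refine tendsto_one_sub_exp_neg_div (fun n => mul_nonneg (nullSeq_pos n).le hy) ?_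
  refine tendsto_const_nhds.congr fun n => ?_
  have := (nullSeq_pos n).ne'
  field_simp

variable {Ω : Type*} [MeasurableSpace Ω] {ν : Measure Ω} [IsProbabilityMeasure ν] {f : Ω → ℝ}

theorem integrable_exp_neg_mul (hf : Measurable f) (h0 : ∀ ω, 0 ≤ f ω) {c : ℝ} (hc : 0 ≤ c) :
    Integrable (fun ω => Real.exp (-(c * f ω))) ν := by
  refine (integrable_const (1 : ℝ)).mono (by fun_prop) (ae_of_all _ fun ω => ?_)
  rw [Real.norm_eq_abs, Real.abs_exp, norm_one, Real.exp_le_one_iff, neg_nonpos]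
  exact mul_nonneg hc (h0 ω)

theorem integral_one_sub_exp_div (hf : Measurable f) (h0 : ∀ ω, 0 ≤ f ω) (n : ℕ) :
    ∫ ω, (1 - Real.exp (-(nullSeq n * f ω))) / nullSeq n ∂ν =
      (1 - ∫ ω, Real.exp (-(nullSeq n * f ω)) ∂ν) / nullSeq n := by
  rw [integral_div, integral_sub (integrable_const _)
    (integrable_exp_neg_mul hf h0 (nullSeq_pos n).le)]
  simp

/-- A nonnegative function whose Laplace transform is Lipschitz at the origin is integrable. -/
theorem integrable_of_laplace_le (hf : Measurable f) (h0 : ∀ ω, 0 ≤ f ω) {C : ℝ}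
    (h : ∀ᶠ n in atTop, (1 - ∫ ω, Real.exp (-(nullSeq n * f ω)) ∂ν) / nullSeq n ≤ C) :
    Integrable f ν := by
  refine ⟨hf.aestronglyMeasurable, ?_⟩
  rw [hasFiniteIntegral_iff_ofReal (ae_of_all _ h0)]
  have hle : ∀ n ω, 0 ≤ (1 - Real.exp (-(nullSeq n * f ω))) / nullSeq n := fun n ω =>
    div_nonneg (sub_nonneg.2 (Real.exp_le_one_iff.2 (neg_nonpos.2
      (mul_nonneg (nullSeq_pos n).le (h0 ω))))) (nullSeq_pos n).le
  have h1 : ∀ ω, ENNReal.ofReal (f ω) = liminf (fun n =>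
      ENNReal.ofReal ((1 - Real.exp (-(nullSeq n * f ω))) / nullSeq n)) atTop := fun ω =>
    ((ENNReal.continuous_ofReal.tendsto _).comp
      (tendsto_pointwise_laplace_quotient (h0 ω))).liminf_eq.symm
  simp_rw [h1]
  -- Fatou's lemma, since the quotients converge pointwise to `f`.
  refine (lintegral_liminf_le fun n => by fun_prop).trans_lt ?_
  refine lt_of_le_of_lt (liminf_le_of_frequently_le' (x := ENNReal.ofReal C) ?_) ENNReal.ofReal_lt_top
  refine Eventually.frequently (h.mono fun n hn => ?_)
  rw [← ofReal_integral_eq_lintegral_ofReal _ (ae_of_all _ (hle n)),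
    integral_one_sub_exp_div hf h0]
  · exact ENNReal.ofReal_le_ofReal hn
  · exact ((integrable_const _).sub (integrable_exp_neg_mul hf h0 (nullSeq_pos n).le)).div_const _

/-- The first moment is the derivative of the Laplace transform at the origin. -/
theorem tendsto_laplace_quotient (h0 : ∀ ω, 0 ≤ f ω) (hm : Measurable f) (hf : Integrable f ν) :
    Tendsto (fun n => (1 - ∫ ω, Real.exp (-(nullSeq n * f ω)) ∂ν) / nullSeq n) atTop
      (𝓝 (∫ ω, f ω ∂ν)) := by
  simp_rw [← integral_one_sub_exp_div hm h0]
  refine tendsto_integral_of_dominated_convergence f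
    (fun n => by fun_prop) hf (fun n => ae_of_all _ fun ω => ?_)
    (ae_of_all _ fun ω => tendsto_pointwise_laplace_quotient (h0 ω))
  have hn := nullSeq_pos n
  rw [norm_div, Real.norm_of_nonneg hn.le, div_le_iff₀ hn, Real.norm_eq_abs, abs_sub_comm, mul_comm (f ω)]
  exact AffinePSD.exp_neg_sub_one_abs_le (mul_nonneg hn.le (h0 ω))

end LaplaceMoments

namespace AffinePSD
variable {d : ℕ}

namespace AdmissibleParameters

variable (P : AdmissibleParameters d)

/-- The mean of the process at time `t` when started at `x`. -/
noncomputable def mean (t : ℝ) (x : SymMat d) : SymMat d :=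
  NormedSpace.exp (t • P.effectiveDrift) x + P.meanImmigration t

/-! ### Means of the transition laws -/

namespace IsRiccatiSolution

variable {P} {φ : ℝ → Cone d → ℝ} {ψ : ℝ → Cone d → Cone d}

theorem monotone_phi (h : P.IsRiccatiSolution φ ψ) (u : Cone d) :
    MonotoneOn (fun t => φ t u) (Ici 0) := by
  obtain ⟨-, -, hd⟩ := h u
  exact monotoneOn_of_hasDerivWithinAt_nonneg (convex_Ici 0)
    (fun s hs => (hd s hs).1.continuousWithinAt)
    (fun s hs => (hd s (interior_subset hs)).1.mono interior_subset)
    fun s hs => P.F_nonneg (ψ s u).2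

theorem phi_nonneg (h : P.IsRiccatiSolution φ ψ) (u : Cone d) {t : ℝ} (ht : 0 ≤ t) :
    0 ≤ φ t u := by
  have := h.monotone_phi u (mem_Ici.2 le_rfl) (mem_Ici.2 ht) ht
  simpa [(h u).1] using this

theorem tendsto_exponent_div (h : P.IsRiccatiSolution φ ψ)
    (hm : Integrable (fun ξ : PuncturedCone d => (ξ : SymMat d)) P.m) (u x : Cone d) {t : ℝ}
    (ht : 0 ≤ t) :
    Tendsto (fun n => (φ t (coneSMul (nullSeq n) u) +
      inner ℝ (ψ t (coneSMul (nullSeq n) u) : SymMat d) (x : SymMat d)) / nullSeq n) atTop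
      (𝓝 (inner ℝ (u : SymMat d) (P.mean t x))) := by
  rw [Metric.tendsto_atTop']
  intro e he
  -- The share `‖x‖` pays for `ψ`, one unit for `φ`, and one unit makes the final inequality strict.
  have he' : 0 < e / (‖(x : SymMat d)‖ + 2) := by positivity
  obtain ⟨ε₁, hε₁, h1⟩ := h.linearize_psi u ht he'
  obtain ⟨ε₂, hε₂, h2⟩ := h.linearize_phi hm u ht he'
  obtain ⟨N, hN⟩ := eventually_atTop.1
    (tendsto_nullSeq.eventually_lt_const (lt_min hε₁ hε₂))
  refine ⟨N, fun n hn => ?_⟩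
  obtain ⟨ha, hb⟩ := lt_min_iff.1 (hN n hn.le)
  have hn0 := nullSeq_pos n
  have k1 := h1 _ ha t ⟨ht, le_rfl⟩
  have k2 := h2 _ hb
  have k3 := (norm_inner_le_norm (𝕜 := ℝ) _ (x : SymMat d)).trans
    (mul_le_mul_of_nonneg_right k1 (norm_nonneg (x : SymMat d)))
  rw [inner_sub_left, real_inner_smul_left, inner_exp_smul_adjoint, Real.norm_eq_abs] at k3
  rw [Real.dist_eq, mean, inner_add_right, div_sub' hn0.ne', abs_div, abs_of_pos hn0,
    div_lt_iff₀ hn0]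
  have k4 := (abs_add_le _ _).trans (add_le_add k2 k3)
  refine lt_of_le_of_lt (le_trans (le_of_eq ?_) k4) ?_
  · congr 1
    ring
  · have : e = e / (‖(x : SymMat d)‖ + 2) * (‖(x : SymMat d)‖ + 2) := by field_simp
    have h5 : 0 < e / (‖(x : SymMat d)‖ + 2) * nullSeq n := by positivity
    nlinarith

variable {ν : Measure (Cone d)} {t : ℝ} {x : Cone d}

theorem tendsto_laplace_quotient (h : P.IsRiccatiSolution φ ψ)
    (hm : Integrable (fun ξ : PuncturedCone d => (ξ : SymMat d)) P.m) (ht : 0 ≤ t)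
    (hν : ∀ u : Cone d, ∫ ξ, Real.exp (-inner ℝ (u : SymMat d) (ξ : SymMat d)) ∂ν =
      Real.exp (-φ t u - inner ℝ (ψ t u : SymMat d) (x : SymMat d))) (u : Cone d) :
    Tendsto (fun n => (1 - ∫ y, Real.exp (-(nullSeq n *
      inner ℝ (u : SymMat d) (y : SymMat d))) ∂ν) / nullSeq n) atTop
      (𝓝 (inner ℝ (u : SymMat d) (P.mean t x))) := by
  refine (tendsto_one_sub_exp_neg_div (fun n => add_nonneg (h.phi_nonneg _ ht)
    (inner_nonneg_of_mem_cone (ψ t _).2 x.2)) (h.tendsto_exponent_div hm u x ht)).congr fun n => ?_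
  have := hν (coneSMul (nullSeq n) u)
  simp only [coe_coneSMul, real_inner_smul_left] at this
  rw [this, neg_add']

variable [IsProbabilityMeasure ν]

theorem integrable_inner (h : P.IsRiccatiSolution φ ψ)
    (hm : Integrable (fun ξ : PuncturedCone d => (ξ : SymMat d)) P.m) (ht : 0 ≤ t)
    (hν : ∀ u : Cone d, ∫ ξ, Real.exp (-inner ℝ (u : SymMat d) (ξ : SymMat d)) ∂ν =
      Real.exp (-φ t u - inner ℝ (ψ t u : SymMat d) (x : SymMat d))) (u : Cone d) :
    Integrable (fun y : Cone d => inner ℝ (u : SymMat d) (y : SymMat d)) ν :=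
  integrable_of_laplace_le (by fun_prop) (fun y => inner_nonneg_of_mem_cone u.2 y.2)
    ((h.tendsto_laplace_quotient hm ht hν u).eventually_le_const (lt_add_one _))

end IsRiccatiSolution
end AdmissibleParameters

theorem integrable_coe_of_inner_oneCone {ν : Measure (Cone d)}
    (h : Integrable (fun y : Cone d => inner ℝ (oneCone d : SymMat d) (y : SymMat d)) ν) :
    Integrable (fun y : Cone d => (y : SymMat d)) ν :=
  h.mono' (by fun_prop) (ae_of_all _ fun y => norm_le_inner_oneCone y.2)

namespace AdmissibleParameters.IsRiccatiSolution

variable {P : AdmissibleParameters d} {φ : ℝ → Cone d → ℝ} {ψ : ℝ → Cone d → Cone d}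

variable {ν : Measure (Cone d)} [IsProbabilityMeasure ν] {t : ℝ} {x : Cone d}

theorem integrable_coe (h : P.IsRiccatiSolution φ ψ)
    (hm : Integrable (fun ξ : PuncturedCone d => (ξ : SymMat d)) P.m) (ht : 0 ≤ t)
    (hν : ∀ u : Cone d, ∫ ξ, Real.exp (-inner ℝ (u : SymMat d) (ξ : SymMat d)) ∂ν =
      Real.exp (-φ t u - inner ℝ (ψ t u : SymMat d) (x : SymMat d))) :
    Integrable (fun y : Cone d => (y : SymMat d)) ν :=
  integrable_coe_of_inner_oneCone (h.integrable_inner hm ht hν (oneCone d))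

/-- The same Laplace quotient has two limits: the first moment, by dominated convergence, and the
derivative of the exponent, by the linearized Riccati flow. -/
theorem integral_coe (h : P.IsRiccatiSolution φ ψ)
    (hm : Integrable (fun ξ : PuncturedCone d => (ξ : SymMat d)) P.m) (ht : 0 ≤ t)
    (hν : ∀ u : Cone d, ∫ ξ, Real.exp (-inner ℝ (u : SymMat d) (ξ : SymMat d)) ∂ν =
      Real.exp (-φ t u - inner ℝ (ψ t u : SymMat d) (x : SymMat d))) :
    ∫ y, (y : SymMat d) ∂ν = P.mean t x := by
  refine ext_inner_cone fun u => ?_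
  rw [← integral_inner (h.integrable_coe hm ht hν)]
  exact tendsto_nhds_unique (_root_.tendsto_laplace_quotient
    (fun y => inner_nonneg_of_mem_cone u.2 y.2) (by fun_prop) (h.integrable_inner hm ht hν u))
    (h.tendsto_laplace_quotient hm ht hν u)

/-- Jensen's inequality for the affine transform formula. -/
theorem exponent_le (h : P.IsRiccatiSolution φ ψ)
    (hm : Integrable (fun ξ : PuncturedCone d => (ξ : SymMat d)) P.m) (ht : 0 ≤ t)
    (hν : ∀ u : Cone d, ∫ ξ, Real.exp (-inner ℝ (u : SymMat d) (ξ : SymMat d)) ∂ν =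
      Real.exp (-φ t u - inner ℝ (ψ t u : SymMat d) (x : SymMat d))) (u : Cone d) :
    φ t u + inner ℝ (ψ t u : SymMat d) (x : SymMat d) ≤ inner ℝ (u : SymMat d) (P.mean t x) := by
  have hi := h.integrable_inner hm ht hν u
  have hj := convexOn_exp.map_integral_le (μ := ν)
    (f := fun y : Cone d => -inner ℝ (u : SymMat d) (y : SymMat d))
    Real.continuous_exp.continuousOn isClosed_univ (ae_of_all _ fun _ => mem_univ _) hi.neg
    ((laplaceFun u).integrable ν)
  rw [hν u, integral_neg, integral_inner (h.integrable_coe hm ht hν), h.integral_coe hm ht hν,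
    Real.exp_le_exp] at hj
  linarith

end AdmissibleParameters.IsRiccatiSolution

end AffinePSD

namespace AffinePSD
variable {d : ℕ}

theorem integral_bind_kernel {Ω E : Type*} [MeasurableSpace Ω] [NormedAddCommGroup E]
    [NormedSpace ℝ E] {κ : Kernel Ω Ω} [IsSFiniteKernel κ] {ν : Measure Ω} [SFinite ν] {f : Ω → E}
    (hf : Integrable f (ν.bind κ)) : ∫ y, f y ∂(ν.bind κ) = ∫ x, ∫ y, f y ∂(κ x) ∂ν := by
  rw [Measure.comp_eq_comp_const_apply] at hf ⊢
  rw [Kernel.integral_comp hf, Kernel.const_apply]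

namespace AdmissibleParameters

variable {P : AdmissibleParameters d}

/-! ### Long-time behaviour in the subcritical case -/

theorem Subcritical.exists_norm_exp_le (hP : P.Subcritical) : ∃ C δ : ℝ, 0 < δ ∧ 0 ≤ C ∧
    ∀ t : ℝ, 0 ≤ t → ‖NormedSpace.exp (t • P.effectiveDrift)‖ ≤ C * Real.exp (-δ * t) := by
  refine P.effectiveDrift.exists_norm_exp_smul_le_of_spectrum fun z hz => ?_
  refine lt_of_le_of_lt (le_csSup ?_ (mem_image_of_mem _ hz)) hP
  -- Finiteness of the spectrum makes the real supremum a genuine upper bound.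
  exact ((Module.End.finite_spectrum _).image _).bddAbove

theorem Subcritical.tendsto_exp (hP : P.Subcritical) :
    Tendsto (fun t : ℝ => NormedSpace.exp (t • P.effectiveDrift)) atTop (𝓝 0) := by
  obtain ⟨C, δ, hδ, -, h⟩ := hP.exists_norm_exp_le
  have h1 : Tendsto (fun t : ℝ => C * Real.exp (-δ * t)) atTop (𝓝 0) := by
    have : Tendsto (fun t : ℝ => -δ * t) atTop atBot :=
      tendsto_id.const_mul_atTop_of_neg (neg_lt_zero.2 hδ)
    simpa using (Real.tendsto_exp_atBot.comp this).const_mul C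
  refine squeeze_zero_norm' ?_ h1
  filter_upwards [eventually_ge_atTop 0] with t ht using h t ht

theorem Subcritical.tendsto_exp_apply (hP : P.Subcritical) (x : SymMat d) :
    Tendsto (fun t : ℝ => NormedSpace.exp (t • P.effectiveDrift) x) atTop (𝓝 0) := by
  have h := ((ContinuousLinearMap.apply ℝ (SymMat d) x).continuous.tendsto 0).comp hP.tendsto_exp
  rw [map_zero] at h
  exact h

theorem Subcritical.integrableOn_exp (hP : P.Subcritical) (β : SymMat d) :
    IntegrableOn (fun s : ℝ => NormedSpace.exp (s • P.effectiveDrift) β) (Ioi 0) := by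
  obtain ⟨C, δ, hδ, -, h⟩ := hP.exists_norm_exp_le
  have hc : Continuous fun s : ℝ => NormedSpace.exp (s • P.effectiveDrift) β :=
    (ContinuousLinearMap.continuous_exp_smul _).clm_apply continuous_const
  refine (((exp_neg_integrableOn_Ioi 0 hδ).const_mul C).mul_const ‖β‖).mono'
    hc.aestronglyMeasurable ?_
  refine (ae_restrict_iff' measurableSet_Ioi).2 (ae_of_all _ fun s hs => ?_)
  exact (ContinuousLinearMap.le_opNorm _ _).trans
    (mul_le_mul_of_nonneg_right (h s (le_of_lt hs)) (norm_nonneg _))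

variable (P) in
/-- The mean of the invariant distribution. -/
noncomputable def limitMean : SymMat d :=
  ∫ s in Ioi (0 : ℝ), NormedSpace.exp (s • P.effectiveDrift)
    (P.b + ∫ ξ : PuncturedCone d, (ξ : SymMat d) ∂P.m)

theorem Subcritical.tendsto_mean (hP : P.Subcritical) (x : SymMat d) :
    Tendsto (fun t : ℝ≥0 => P.mean t x) atTop (𝓝 P.limitMean) := by
  have h1 : Tendsto (fun t : ℝ => P.meanImmigration t) atTop (𝓝 P.limitMean) :=
    intervalIntegral_tendsto_integral_Ioi 0 (hP.integrableOn_exp _) tendsto_id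
  have h3 := (hP.tendsto_exp_apply x).add h1
  rw [zero_add] at h3
  exact h3.comp (NNReal.tendsto_coe_atTop.2 tendsto_id)

/-! ### Convergence of the Laplace transforms -/

namespace IsTransitionKernel

variable {p : ℝ≥0 → Kernel (Cone d) (Cone d)} {φ : ℝ → Cone d → ℝ} {ψ : ℝ → Cone d → Cone d}

/-- Jensen's bound is applied at the starting point `x / ε`, and `φ ≥ 0` is dropped. After
multiplication by `ε` the immigration term carries a factor `ε` and vanishes as `ε → 0`. -/
theorem inner_psi_le (hp : P.IsTransitionKernel p) (h : P.IsRiccatiSolution φ ψ)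
    (hm : Integrable (fun ξ : PuncturedCone d => (ξ : SymMat d)) P.m)
    (hl : ∀ (t : ℝ≥0) (x u : Cone d),
      ∫ ξ, Real.exp (-inner ℝ (u : SymMat d) (ξ : SymMat d)) ∂(p t x) =
        Real.exp (-φ t u - inner ℝ (ψ t u : SymMat d) (x : SymMat d)))
    (t : ℝ≥0) (u x : Cone d) :
    inner ℝ (ψ t u : SymMat d) (x : SymMat d) ≤
      inner ℝ (u : SymMat d) (NormedSpace.exp ((t : ℝ) • P.effectiveDrift) (x : SymMat d)) := by
  have := hp.isMarkovKernel t
  have key : ∀ n : ℕ, inner ℝ (ψ t u : SymMat d) (x : SymMat d) ≤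
      inner ℝ (u : SymMat d) (NormedSpace.exp ((t : ℝ) • P.effectiveDrift) (x : SymMat d)) +
        inner ℝ (u : SymMat d) (P.meanImmigration t) * nullSeq n := by
    intro n
    have hn := nullSeq_pos n
    have h1 := h.exponent_le hm t.2 (hl t (coneSMul (nullSeq n)⁻¹ x)) u
    have h2 := h.phi_nonneg u t.2
    rw [mean, inner_add_right, coe_coneSMul, map_smul, real_inner_smul_right,
      real_inner_smul_right, NNReal.coe_inv] at h1
    have h3 : (nullSeq n : ℝ)⁻¹ * inner ℝ (ψ t u : SymMat d) (x : SymMat d) ≤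
      (nullSeq n : ℝ)⁻¹ * inner ℝ (u : SymMat d)
        (NormedSpace.exp ((t : ℝ) • P.effectiveDrift) (x : SymMat d)) +
        inner ℝ (u : SymMat d) (P.meanImmigration t) := by
      change 0 ≤ φ (t : ℝ) u at h2
      linarith!
    have h4 := mul_le_mul_of_nonneg_left h3 hn.le
    rw [mul_add, mul_inv_cancel_left₀ hn.ne', mul_inv_cancel_left₀ hn.ne'] at h4
    linarith
  refine ge_of_tendsto' (x := atTop) ?_ key
  simpa using (tendsto_nullSeq.const_mul (inner ℝ (u : SymMat d) (P.meanImmigration t))).const_add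
    (inner ℝ (u : SymMat d) (NormedSpace.exp ((t : ℝ) • P.effectiveDrift) (x : SymMat d)))

theorem tendsto_psi (hp : P.IsTransitionKernel p) (hP : P.Subcritical)
    (h : P.IsRiccatiSolution φ ψ)
    (hm : Integrable (fun ξ : PuncturedCone d => (ξ : SymMat d)) P.m)
    (hl : ∀ (t : ℝ≥0) (x u : Cone d),
      ∫ ξ, Real.exp (-inner ℝ (u : SymMat d) (ξ : SymMat d)) ∂(p t x) =
        Real.exp (-φ t u - inner ℝ (ψ t u : SymMat d) (x : SymMat d))) (u : Cone d) :
    Tendsto (fun t : ℝ≥0 => (ψ t u : SymMat d)) atTop (𝓝 0) := by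
  refine squeeze_zero_norm (fun t => (norm_le_inner_oneCone (ψ t u).2).trans
    ((real_inner_comm _ _).le.trans (hp.inner_psi_le h hm hl t u (oneCone d)))) ?_
  have h1 : Tendsto (fun t : ℝ≥0 => NormedSpace.exp ((t : ℝ) • P.effectiveDrift)
      (oneCone d : SymMat d)) atTop (𝓝 0) :=
    (hP.tendsto_exp_apply _).comp (NNReal.tendsto_coe_atTop.2 tendsto_id)
  simpa using (tendsto_const_nhds (x := (u : SymMat d))).inner (𝕜 := ℝ) h1

/-- `φ` increases because `F ≥ 0` on the cone. Divergence is impossible, since Jensen's bound at one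
starting point dominates it by a convergent function of time. -/
theorem exists_tendsto_phi (hp : P.IsTransitionKernel p) (hP : P.Subcritical)
    (h : P.IsRiccatiSolution φ ψ)
    (hm : Integrable (fun ξ : PuncturedCone d => (ξ : SymMat d)) P.m)
    (hl : ∀ (t : ℝ≥0) (x u : Cone d),
      ∫ ξ, Real.exp (-inner ℝ (u : SymMat d) (ξ : SymMat d)) ∂(p t x) =
        Real.exp (-φ t u - inner ℝ (ψ t u : SymMat d) (x : SymMat d))) (u : Cone d) :
    ∃ l, Tendsto (fun t : ℝ≥0 => φ t u) atTop (𝓝 l) := by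
  have hmono : Monotone fun t : ℝ≥0 => φ t u := fun s t hst =>
    h.monotone_phi u s.2 t.2 hst
  refine (tendsto_atTop_of_monotone hmono).resolve_left fun htop => ?_
  have hle : ∀ t : ℝ≥0, φ t u ≤ inner ℝ (u : SymMat d) (P.mean t (oneCone d)) := by
    intro t
    have := hp.isMarkovKernel t
    have h1 := h.exponent_le hm t.2 (hl t (oneCone d)) u
    have h2 := inner_nonneg_of_mem_cone (ψ t u).2 (oneCone d).2
    exact (le_add_of_nonneg_right h2).trans h1
  exact not_tendsto_nhds_of_tendsto_atTop (tendsto_atTop_mono hle htop) _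
    ((tendsto_const_nhds (x := (u : SymMat d))).inner (𝕜 := ℝ) (hP.tendsto_mean (oneCone d)))

/-- The Laplace transforms of the transition probabilities converge, with a limit that does not
depend on the starting point. -/
theorem exists_laplace_limit (hp : P.IsTransitionKernel p) (hP : P.Subcritical)
    (hm : Integrable (fun ξ : PuncturedCone d => (ξ : SymMat d)) P.m) :
    ∃ L : Cone d → ℝ, ∀ u x : Cone d,
      Tendsto (fun t : ℝ≥0 => ∫ y, laplaceFun u y ∂(p t x)) atTop (𝓝 (L u)) := by
  obtain ⟨φ, ψ, h, hl⟩ := hp.laplace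
  choose l hlim using hp.exists_tendsto_phi hP h hm hl
  refine ⟨fun u => Real.exp (-l u), fun u x => ?_⟩
  have h1 := (hlim u).neg.sub
    ((hp.tendsto_psi hP h hm hl u).inner (𝕜 := ℝ) (tendsto_const_nhds (x := (x : SymMat d))))
  rw [inner_zero_left, sub_zero] at h1
  exact ((Real.continuous_exp.tendsto _).comp h1).congr fun t => (hl t x u).symm

theorem integrable_coe (hp : P.IsTransitionKernel p)
    (hm : Integrable (fun ξ : PuncturedCone d => (ξ : SymMat d)) P.m) (t : ℝ≥0) (x : Cone d) :
    Integrable (fun y : Cone d => (y : SymMat d)) (p t x) := by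
  obtain ⟨φ, ψ, h, hl⟩ := hp.laplace
  have := hp.isMarkovKernel t
  exact h.integrable_coe hm t.2 (hl t x)

theorem integral_coe (hp : P.IsTransitionKernel p)
    (hm : Integrable (fun ξ : PuncturedCone d => (ξ : SymMat d)) P.m) (t : ℝ≥0) (x : Cone d) :
    ∫ y, (y : SymMat d) ∂(p t x) = P.mean t x := by
  obtain ⟨φ, ψ, h, hl⟩ := hp.laplace
  have := hp.isMarkovKernel t
  exact h.integral_coe hm t.2 (hl t x)

/-- The affine property in dual form: the semigroup maps an exponential to a multiple of an
exponential. Both `c` and `v` are independent of `ν`, so one pair serves for `π` and for all `p_s(x,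
·)`. -/
theorem exists_integral_laplaceFun_bind (hp : P.IsTransitionKernel p) (t : ℝ≥0) (u : Cone d) :
    ∃ (c : ℝ) (v : Cone d), ∀ ν : Measure (Cone d), IsFiniteMeasure ν →
      ∫ y, laplaceFun u y ∂(ν.bind (p t)) = c * ∫ x, laplaceFun v x ∂ν := by
  obtain ⟨φ, ψ, h, hl⟩ := hp.laplace
  refine ⟨Real.exp (-φ t u), ψ t u, fun ν hν => ?_⟩
  have := hp.isMarkovKernel t
  rw [integral_bind_kernel ((laplaceFun u).integrable _), ← integral_const_mul]
  refine integral_congr_ae (ae_of_all _ fun x => ?_)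
  simp only [laplaceFun_apply]
  rw [hl t x u, ← Real.exp_add, sub_eq_add_neg]

theorem exists_integral_inner_oneCone_le (hp : P.IsTransitionKernel p) (hP : P.Subcritical)
    (hm : Integrable (fun ξ : PuncturedCone d => (ξ : SymMat d)) P.m) (x : Cone d) :
    ∃ C : ℝ, ∀ n : ℕ, ∫ y, inner ℝ (oneCone d : SymMat d) (y : SymMat d) ∂(p n x) ≤ C := by
  have h1 : Tendsto (fun n : ℕ => inner ℝ (oneCone d : SymMat d) (P.mean ((n : ℝ≥0) : ℝ) x)) atTop
      (𝓝 (inner ℝ (oneCone d : SymMat d) P.limitMean)) :=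
    (tendsto_const_nhds (x := (oneCone d : SymMat d))).inner (𝕜 := ℝ)
      ((hP.tendsto_mean x).comp tendsto_natCast_atTop_atTop)
  obtain ⟨C, hC⟩ := h1.bddAbove_range
  refine ⟨C, fun n => ?_⟩
  rw [integral_inner (hp.integrable_coe hm n x), hp.integral_coe hm]
  exact hC ⟨n, rfl⟩

end IsTransitionKernel

end AdmissibleParameters

/-! ### Existence of a limit law -/

theorem isCompact_inner_oneCone_le (R : ℝ) :
    IsCompact {y : Cone d | inner ℝ (oneCone d : SymMat d) (y : SymMat d) ≤ R} := by
  have h1 : IsCompact {y : Cone d | (y : SymMat d) ∈ Metric.closedBall 0 R} :=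
    (isClosed_cone d).isClosedEmbedding_subtypeVal.isCompact_preimage (isCompact_closedBall _ _)
  refine h1.of_isClosed_subset (isClosed_le (by fun_prop) continuous_const) fun y hy => ?_
  exact mem_closedBall_zero_iff.2 ((norm_le_inner_oneCone y.2).trans hy)

/-- A sequence of laws with bounded first moments and converging Laplace transforms has a limit
law. -/
theorem exists_laplace_eq_of_tendsto (ν : ℕ → ProbabilityMeasure (Cone d)) {C : ℝ}
    (hi : ∀ n, Integrable (fun y : Cone d => inner ℝ (oneCone d : SymMat d) (y : SymMat d)) (ν n))
    (hC : ∀ n, ∫ y, inner ℝ (oneCone d : SymMat d) (y : SymMat d) ∂(ν n : Measure (Cone d)) ≤ C)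
    {L : Cone d → ℝ}
    (hL : ∀ u, Tendsto (fun n => ∫ y, laplaceFun u y ∂(ν n : Measure (Cone d))) atTop (𝓝 (L u))) :
    ∃ π : ProbabilityMeasure (Cone d), ∀ u, ∫ y, laplaceFun u y ∂(π : Measure (Cone d)) = L u := by
  have htight : IsTightMeasureSet {((μ : ProbabilityMeasure (Cone d)) : Measure (Cone d)) |
      μ ∈ range ν} := by
    rw [isTightMeasureSet_iff_exists_isCompact_measure_compl_le]
    intro ε hε
    obtain ⟨r, hr0, hr⟩ : ∃ r : ℝ, 0 < r ∧ ENNReal.ofReal r ≤ ε := by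
      obtain ⟨r, hr0, hr⟩ := ENNReal.lt_iff_exists_nnreal_btwn.1 hε
      exact ⟨r, by simpa using hr0, by simpa using hr.le⟩
    -- Markov's inequality at this level leaves mass at most `r` outside; `|C| + 1` is positive
    -- whatever the sign of `C`.
    have hR : 0 < (|C| + 1) / r := by positivity
    refine ⟨_, isCompact_inner_oneCone_le ((|C| + 1) / r), ?_⟩
    rintro _ ⟨_, ⟨n, rfl⟩, rfl⟩
    refine le_trans ?_ hr
    have hM := mul_meas_ge_le_integral_of_nonneg (μ := (ν n : Measure (Cone d)))
      (ae_of_all _ fun y => inner_nonneg_of_mem_cone (oneCone d).2 y.2) (hi n) ((|C| + 1) / r)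
    have hsub : {y : Cone d | inner ℝ (oneCone d : SymMat d) (y : SymMat d) ≤ (|C| + 1) / r}ᶜ ⊆
        {y : Cone d | (|C| + 1) / r ≤ inner ℝ (oneCone d : SymMat d) (y : SymMat d)} :=
      fun y hy => by
        rw [mem_compl_iff, mem_ofPred_eq, not_le] at hy
        exact hy.le
    refine (measure_mono hsub).trans ?_
    rw [← ENNReal.ofReal_toReal (measure_ne_top _ _)]
    refine ENNReal.ofReal_le_ofReal ?_
    have h1 := hM.trans ((hC n).trans ((le_abs_self C).trans (le_add_of_nonneg_right zero_le_one)))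
    rw [div_mul_eq_mul_div, div_le_iff₀ hr0] at h1
    exact le_of_mul_le_mul_left h1 (by positivity)
  -- By Prokhorov a weak cluster point exists. That is enough: its transform is a cluster point of a
  -- convergent sequence, hence equals the limit.
  obtain ⟨π, -, hπ⟩ := (isCompact_closure_of_isTightMeasureSet htight).exists_mapClusterPt
    (f := atTop) (u := ν)
    (tendsto_principal.2 (Eventually.of_forall fun n => subset_closure (mem_range_self n)))
  refine ⟨π, fun u => ?_⟩
  have h1 := hπ.continuousAt_comp
    (ProbabilityMeasure.continuous_integral_boundedContinuousFunction
      (laplaceFun u)).continuousAt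
  have h2 : (𝓝 (∫ y, laplaceFun u y ∂(π : Measure (Cone d))) ⊓ 𝓝 (L u)).NeBot :=
    NeBot.mono h1 (inf_le_inf_left _ (hL u))
  exact eq_of_nhds_neBot h2

/-! ### Invariance, uniqueness and mean of the limit law -/

namespace AdmissibleParameters.IsTransitionKernel

variable {P : AdmissibleParameters d} {p : ℝ≥0 → Kernel (Cone d) (Cone d)} {L : Cone d → ℝ}
  {π : Measure (Cone d)}

/-- The transform of `p_{s+t}` tends to `L(u)` as `s → ∞`, and by Chapman–Kolmogorov also to `c
L(v)`, which is the transform of `π p_t`. -/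
theorem invariant_of_laplace_eq (hp : P.IsTransitionKernel p)
    (hL : ∀ u x : Cone d, Tendsto (fun t : ℝ≥0 => ∫ y, laplaceFun u y ∂(p t x)) atTop (𝓝 (L u)))
    [IsProbabilityMeasure π] (hπ : ∀ u, ∫ y, laplaceFun u y ∂π = L u) (t : ℝ≥0) :
    Kernel.Invariant (p t) π := by
  have := fun t => hp.isMarkovKernel t
  refine ext_of_laplace fun u => ?_
  obtain ⟨c, v, hcv⟩ := hp.exists_integral_laplaceFun_bind t u
  rw [hcv π inferInstance, hπ, hπ]
  have h1 := (hL v (oneCone d)).const_mul c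
  have h2 := (hL u (oneCone d)).comp
    (tendsto_atTop_mono (fun s : ℝ≥0 => (le_self_add : s ≤ s + t)) tendsto_id)
  refine tendsto_nhds_unique h1 (h2.congr fun s => ?_)
  simp only [Function.comp_apply]
  rw [hp.chapman_kolmogorov, Kernel.comp_apply, hcv _ inferInstance]

/-- Invariance makes the average over `π` of the transforms of `p_n(x, ·)` constant in `n`; since
their limit does not depend on `x`, that constant is `L(u)`. -/
theorem laplace_eq_of_invariant (hp : P.IsTransitionKernel p)
    (hL : ∀ u x : Cone d, Tendsto (fun t : ℝ≥0 => ∫ y, laplaceFun u y ∂(p t x)) atTop (𝓝 (L u)))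
    [IsProbabilityMeasure π] (hπ : ∀ t, Kernel.Invariant (p t) π) (u : Cone d) :
    ∫ y, laplaceFun u y ∂π = L u := by
  have := fun t => hp.isMarkovKernel t
  have h1 : ∀ n : ℕ, ∫ x, ∫ y, laplaceFun u y ∂(p n x) ∂π = ∫ y, laplaceFun u y ∂π := by
    intro n
    conv_rhs => rw [← hπ n]
    exact (integral_bind_kernel ((laplaceFun u).integrable _)).symm
  have h2 : Tendsto (fun n : ℕ => ∫ x, ∫ y, laplaceFun u y ∂(p n x) ∂π) atTop
      (𝓝 (∫ _, L u ∂π)) := by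
    refine tendsto_integral_of_dominated_convergence (fun _ => 1) (fun n => ?_)
      (integrable_const _) (fun n => ae_of_all _ fun x => ?_)
      (ae_of_all _ fun x => (hL u x).comp tendsto_natCast_atTop_atTop)
    · exact ((laplaceFun u).continuous.stronglyMeasurable.integral_kernel).aestronglyMeasurable
    · refine (norm_integral_le_of_norm_le_const (C := 1) (ae_of_all _ fun y => ?_)).trans (by simp)
      rw [laplaceFun_apply, Real.norm_eq_abs, Real.abs_exp, Real.exp_le_one_iff, neg_nonpos]
      exact inner_nonneg_of_mem_cone u.2 y.2
  simp only [h1, integral_const, probReal_univ, one_smul] at h2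
  exact tendsto_nhds_unique tendsto_const_nhds h2

theorem integrable_of_laplace_eq (hp : P.IsTransitionKernel p) (hP : P.Subcritical)
    (hm : Integrable (fun ξ : PuncturedCone d => (ξ : SymMat d)) P.m)
    (hL : ∀ u x : Cone d, Tendsto (fun t : ℝ≥0 => ∫ y, laplaceFun u y ∂(p t x)) atTop (𝓝 (L u)))
    [IsProbabilityMeasure π] (hπ : ∀ u, ∫ y, laplaceFun u y ∂π = L u) :
    Integrable (fun y : Cone d => (y : SymMat d)) π := by
  have := fun t => hp.isMarkovKernel t
  obtain ⟨C, hC⟩ := hp.exists_integral_inner_oneCone_le hP hm (oneCone d)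
  refine integrable_coe_of_inner_oneCone (integrable_of_laplace_le (C := C) (by fun_prop)
    (fun y => inner_nonneg_of_mem_cone (oneCone d).2 y.2) (Eventually.of_forall fun k => ?_))
  have hk := nullSeq_pos k
  have e : ∀ ν : Measure (Cone d), ∫ y, Real.exp (-(nullSeq k *
      inner ℝ (oneCone d : SymMat d) (y : SymMat d))) ∂ν =
      ∫ y, laplaceFun (coneSMul (nullSeq k) (oneCone d)) y ∂ν := by
    intro ν
    simp [real_inner_smul_left]
  rw [e, hπ, div_le_iff₀ hk]
  -- The bound `1 - exp(-s) ≤ s` is integrated against `p_n`, whose means are bounded, and passes to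
  -- the limit in `n`.
  refine le_of_tendsto' (((hL _ (oneCone d)).comp tendsto_natCast_atTop_atTop).const_sub 1)
    fun n => ?_
  have hi : Integrable (fun y : Cone d => inner ℝ (oneCone d : SymMat d) (y : SymMat d))
      (p n (oneCone d)) := (hp.integrable_coe hm n _).const_inner _
  have h1 : ∫ y : Cone d, (1 - nullSeq k * inner ℝ (oneCone d : SymMat d) (y : SymMat d))
      ∂(p n (oneCone d)) ≤
      ∫ y, laplaceFun (coneSMul (nullSeq k) (oneCone d)) y ∂(p n (oneCone d)) := by
    refine integral_mono ((integrable_const _).sub (hi.const_mul _))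
      ((laplaceFun _).integrable _) fun y => ?_
    have := Real.add_one_le_exp
      (-(nullSeq k * inner ℝ (oneCone d : SymMat d) (y : SymMat d)))
    simp only [laplaceFun_apply, coe_coneSMul, real_inner_smul_left]
    linarith
  rw [integral_sub (integrable_const _) (hi.const_mul _), integral_const_mul] at h1
  have h2 := mul_le_mul_of_nonneg_right (hC n) hk.le
  simp only [integral_const, probReal_univ, one_smul] at h1
  simp only [Function.comp_apply]
  linarith

/-- Integrating the mean formula against `π` shows that the mean of `π` is fixed by `P.mean t` for
every `t`; then `t → ∞`. -/
theorem integral_eq_limitMean (hp : P.IsTransitionKernel p) (hP : P.Subcritical)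
    (hm : Integrable (fun ξ : PuncturedCone d => (ξ : SymMat d)) P.m)
    [IsProbabilityMeasure π] (hπ : ∀ t, Kernel.Invariant (p t) π)
    (hi : Integrable (fun y : Cone d => (y : SymMat d)) π) :
    ∫ y, (y : SymMat d) ∂π = P.limitMean := by
  have := fun t => hp.isMarkovKernel t
  have h1 : ∀ t : ℝ≥0, P.mean t (∫ y, (y : SymMat d) ∂π) = ∫ y, (y : SymMat d) ∂π := by
    intro t
    have hi' : Integrable (fun y : Cone d => (y : SymMat d)) (π.bind (p t)) := by
      rwa [(hπ t : π.bind (p t) = π)]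
    conv_rhs => rw [← (hπ t : π.bind (p t) = π)]
    rw [integral_bind_kernel hi']
    simp only [hp.integral_coe hm, mean]
    rw [integral_add (ContinuousLinearMap.integrable_comp _ hi) (integrable_const _),
      ContinuousLinearMap.integral_comp_comm _ hi]
    simp
  exact tendsto_nhds_unique tendsto_const_nhds ((hP.tendsto_mean _).congr h1)

end AdmissibleParameters.IsTransitionKernel

end AffinePSD

/-! ### The main theorem -/

theorem mainTheorem5 (d : ℕ) (hd : 2 ≤ d) (P : AffinePSD.AdmissibleParameters d)
    (hP : P.Subcritical)
    (hm : ∫⁻ ξ in {ξ : AffinePSD.PuncturedCone d | 1 < ‖(ξ : AffinePSD.SymMat d)‖},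
      ‖(ξ : AffinePSD.SymMat d)‖ₑ ∂P.m < ∞)
    (p : ℝ≥0 → Kernel (AffinePSD.Cone d) (AffinePSD.Cone d)) (hp : P.IsTransitionKernel p) :
    ∃ π : Measure (AffinePSD.Cone d),
      AffinePSD.IsInvariantDistribution p π ∧
      (∀ π' : Measure (AffinePSD.Cone d), AffinePSD.IsInvariantDistribution p π' → π' = π) ∧
      Integrable (fun y : AffinePSD.Cone d => (y : AffinePSD.SymMat d)) π ∧
      (∀ (t : ℝ≥0) (x : AffinePSD.Cone d),
        Integrable (fun y : AffinePSD.Cone d => (y : AffinePSD.SymMat d)) (p t x)) ∧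
      (∀ x : AffinePSD.Cone d,
        Tendsto (fun t : ℝ≥0 => ∫ y : AffinePSD.Cone d, (y : AffinePSD.SymMat d) ∂(p t x)) atTop
          (𝓝 (∫ y : AffinePSD.Cone d, (y : AffinePSD.SymMat d) ∂π))) ∧
      Integrable (fun ξ : AffinePSD.PuncturedCone d => (ξ : AffinePSD.SymMat d)) P.m ∧
      IntegrableOn (fun s : ℝ => NormedSpace.exp (s • P.effectiveDrift)
        (P.b + ∫ ξ : AffinePSD.PuncturedCone d, (ξ : AffinePSD.SymMat d) ∂P.m)) (Ioi 0) ∧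
      ∫ y : AffinePSD.Cone d, (y : AffinePSD.SymMat d) ∂π =
        ∫ s in Ioi (0 : ℝ), NormedSpace.exp (s • P.effectiveDrift)
          (P.b + ∫ ξ : AffinePSD.PuncturedCone d, (ξ : AffinePSD.SymMat d) ∂P.m) := by
  have hm' := P.integrable_m hm
  have hmk := fun t => hp.isMarkovKernel t
  obtain ⟨L, hL⟩ := hp.exists_laplace_limit hP hm'
  obtain ⟨C, hC⟩ := hp.exists_integral_inner_oneCone_le hP hm' (AffinePSD.oneCone d)
  -- Integer times and one starting point suffice, as the limit transform is already known along all
  -- times and from all starting points.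
  obtain ⟨π, hπ⟩ := AffinePSD.exists_laplace_eq_of_tendsto
    (fun n : ℕ => ⟨p n (AffinePSD.oneCone d), inferInstance⟩)
    (fun n => (hp.integrable_coe hm' n _).const_inner _) hC
    (fun u => (hL u (AffinePSD.oneCone d)).comp tendsto_natCast_atTop_atTop)
  have hinv := hp.invariant_of_laplace_eq hL hπ
  have hint := hp.integrable_of_laplace_eq hP hm' hL hπ
  have hmean := hp.integral_eq_limitMean hP hm' hinv hint
  refine ⟨π, ⟨inferInstance, hinv⟩, ?_, hint, hp.integrable_coe hm', fun x => ?_, hm',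
    hP.integrableOn_exp _, hmean⟩
  · rintro π' ⟨hπ', hinv'⟩
    exact AffinePSD.ext_of_laplace fun u =>
      (hp.laplace_eq_of_invariant hL hinv' u).trans (hπ u).symm
  · rw [hmean]
    exact (hP.tendsto_mean x).congr fun t => (hp.integral_coe hm' t x).symm
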